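/- For functions $g,h:\mathbb N\to\mathbb R$ write $g\preceq h$ if there is a positive integer $C$ such that $g(n)\le C\,h(Cn+C)+Cn+C$ for all $n\in\mathbb N$. For a group $H$ with a finite generating tuple $s$, the word problem of $H$ with respect to $s$ is solvable in time $\preceq h$ if there are a deterministic multi-tape Turing machine and a function $t:\mathbb N\to\mathbb N$ with $t\preceq h$ such that on every input word $w$ in the letters of $s$ and their formal inverses the machine halts after at most $t(|w|)$ steps, and it accepts if and only if $w$ represents the identity of $H$. Let $\mathcal G$ be a graph of groups with trivial edge groups over a finite connected graph $\Gamma$ (loops and multiple edges are allowed), and let $f:\mathbb N\to\mathbb R$ be a convex function with $f(n)\ge n$ for all $n$. Suppose that each vertex group $G_v$ has a finite generating tuple with respect to which its word problem is solvable in time $\preceq f(n)$. Let $T$ be a spanning tree of $\Gamma$ and let $G=\pi_1(\mathcal G)=\pi_1(\mathcal G,T)$ be the fundamental group of $\mathcal G$, that is, the quotient of the free product of all the vertex groups and of the free group on the edges $e$ of $\Gamma$ (one orientation of each edge, with stable letter $t_e$) by the relations $t_e\,\tau_e(x)\,t_e^{-1}=\tau_{\bar e}(x)$ for all edges $e$ and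 all $x\in G_e$, where $\tau_e$ and $\tau_{\bar e}$ are the inclusions of $G_e$ into the vertex groups at the terminal and the initial vertex of $e$, together with $t_e=1$ for all $e\in T$. Then $G$ is finitely generated, and for every finite generating tuple of $G$ the word problem of $G$ is solvable in time $\preceq \log(n)\,f(n)$. -/

import Mathlib

/-! ## Multi-tape Turing machines -/

/-- A deterministic multi-tape Turing machine with input alphabet `α`. Each cell of each tape holds
an element of `Option Symbol`, with `none` the blank. The input alphabet is part of the tape
alphabet `Symbol`. -/
structure MultiTapeTM (α : Type) where
  /-- index set of the tapes -/
  Tapes : Type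
  /-- the tape alphabet, without the blank -/
  Symbol : Type
  /-- the control states -/
  State : Type
  finiteTapes : Finite Tapes
  finiteSymbol : Finite Symbol
  finiteState : Finite State
  /-- the tape on which the input is written -/
  inputTape : Tapes
  /-- the inclusion of the input alphabet into the tape alphabet -/
  letter : α ↪ Symbol
  /-- the initial state -/
  start : State
  /-- the states in which halting means acceptance -/
  accepting : Set State
  /-- The transition function: given the current state and the contents of the scanned cells, either
  the machine halts (`none`) or it enters a new state and, on each tape, overwrites the scanned cell
  and then moves the head by at most one cell (`none` means that the head stays). -/
  transition : State → (Tapes → Option Symbol) →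
    Option (State × (Tapes → Option Symbol × Option Turing.Dir))

namespace MultiTapeTM

variable {α : Type} (M : MultiTapeTM α)

/-- A configuration: the current state, and the tapes (each one infinite in both directions)
together with the positions of their heads. -/
structure Cfg where
  state : M.State
  tape : M.Tapes → Turing.Tape (Option M.Symbol)

/-- Overwrite the scanned cell, then move the head. -/
def actOn {Γ : Type} (t : Turing.Tape (Option Γ)) (a : Option Γ × Option Turing.Dir) :
    Turing.Tape (Option Γ) :=
  match a.2 with
  | none => t.write a.1
  | some d => (t.write a.1).move d

/-- One step of the machine; `none` means that the machine halts in the given configuration. -/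
def step (c : M.Cfg) : Option M.Cfg :=
  (M.transition c.state fun k => (c.tape k).head).map fun a =>
    ⟨a.1, fun k => actOn (c.tape k) (a.2 k)⟩

open scoped Classical in
/-- The initial configuration: the input tape reads `w`, with the head at the first letter, and all
the other tapes are blank. -/
noncomputable def init (w : List α) : M.Cfg where
  state := M.start
  tape k := if k = M.inputTape then Turing.Tape.mk₁ (w.map fun a => some (M.letter a))
    else Turing.Tape.mk₁ []

/-- `M` decides the language `L` in time `t`: on every input `w` it halts after at most `t |w|`
steps, and it accepts precisely when `w ∈ L`. -/
def DecidesInTime (L : Set (List α)) (t : ℕ → ℕ) : Prop :=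
  ∀ w : List α, ∃ c : M.Cfg,
    Nonempty (StateTransition.EvalsToInTime M.step (M.init w) (some c) (t w.length)) ∧
      M.step c = none ∧ (c.state ∈ M.accepting ↔ w ∈ L)

end MultiTapeTM

/-! ## Complexity of word problems -/

/-- The partial order `f ⪯ g` on growth functions: there is a positive integer `C` with
`f n ≤ C * g (C * n + C) + C * n + C` for all `n`. -/
def GrowthLE (f g : ℕ → ℝ) : Prop :=
  ∃ C : ℕ, 0 < C ∧ ∀ n : ℕ, f n ≤ C * g (C * n + C) + C * n + C

/-- Convexity of a function on the natural numbers: its second differences are nonnegative. -/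
def NatConvex (f : ℕ → ℝ) : Prop :=
  ∀ n : ℕ, 2 * f (n + 1) ≤ f n + f (n + 2)

/-- A tuple of elements of a group that generates it. -/
def IsGeneratingTuple {G : Type*} [Group G] {m : ℕ} (s : Fin m → G) : Prop :=
  Subgroup.closure (Set.range s) = ⊤

/-- The words in the letters `s i` (written `(i, true)`) and their formal inverses (written
`(i, false)`) that represent the identity of the group. -/
def trivialWords {G : Type*} [Group G] {m : ℕ} (s : Fin m → G) : Set (List (Fin m × Bool)) :=
  {w | FreeGroup.lift s (FreeGroup.mk w) = 1}

/-- The word problem with respect to the tuple `s` is solvable on a multi-tape Turing machine in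
time `⪯ f`. -/
def WordProblemInTime {G : Type*} [Group G] {m : ℕ} (s : Fin m → G) (f : ℕ → ℝ) : Prop :=
  ∃ (M : MultiTapeTM (Fin m × Bool)) (t : ℕ → ℕ),
    M.DecidesInTime (trivialWords s) t ∧ GrowthLE (fun n => (t n : ℝ)) f

/-! ## Graphs of groups -/

/-- A graph of groups with vertex set `V`. The underlying graph may have loops and multiple edges;
`E` contains exactly one of the two orientations of each edge, so `e : E` goes from `src e` to
`tgt e`, and the edge group of `e` embeds in the vertex groups at both ends. -/
structure GraphOfGroups (V E : Type*) where
  src : E → V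
  tgt : E → V
  vertexGroup : V → Type*
  edgeGroup : E → Type*
  [vertexGroupGroup : ∀ v, Group (vertexGroup v)]
  [edgeGroupGroup : ∀ e, Group (edgeGroup e)]
  srcHom : ∀ e, edgeGroup e →* vertexGroup (src e)
  tgtHom : ∀ e, edgeGroup e →* vertexGroup (tgt e)
  srcHom_injective : ∀ e, Function.Injective (srcHom e)
  tgtHom_injective : ∀ e, Function.Injective (tgtHom e)

namespace GraphOfGroups

attribute [instance] GraphOfGroups.vertexGroupGroup GraphOfGroups.edgeGroupGroup

variable {V E : Type*} (𝒢 : GraphOfGroups V E)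

/-- A set `T` of edges is (the edge set of) a spanning tree of the underlying graph: no edge of `T`
is a loop, no two edges of `T` have the same ends, and the simple graph on all the vertices that `T`
spans is a tree. Such a `T` exists only if the underlying graph is connected. -/
def IsSpanningTree (T : Set E) : Prop :=
  (∀ e ∈ T, 𝒢.src e ≠ 𝒢.tgt e) ∧
  Set.InjOn (fun e => s(𝒢.src e, 𝒢.tgt e)) T ∧
  (SimpleGraph.fromEdgeSet ((fun e => s(𝒢.src e, 𝒢.tgt e)) '' T)).IsTree

/-- The free product of all the vertex groups and of the free group on the edges. -/
abbrev BigFreeProduct : Type _ :=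
  Monoid.Coprod (Monoid.CoprodI 𝒢.vertexGroup) (FreeGroup E)

/-- A vertex group in the big free product. -/
def vertexIncl (v : V) : 𝒢.vertexGroup v →* 𝒢.BigFreeProduct :=
  Monoid.Coprod.inl.comp Monoid.CoprodI.of

/-- The stable letter of an edge. -/
def stableLetter (e : E) : 𝒢.BigFreeProduct :=
  Monoid.Coprod.inr (FreeGroup.of e)

/-- The relators `t_e * tgt(x) * t_e⁻¹ * src(x)⁻¹` for each edge `e` and each `x` in its edge
group, and `t_e` for each `e ∈ T`. -/
def relators (T : Set E) : Set 𝒢.BigFreeProduct :=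
  {r | ∃ (e : E) (x : 𝒢.edgeGroup e), r =
      𝒢.stableLetter e * 𝒢.vertexIncl (𝒢.tgt e) (𝒢.tgtHom e x) * (𝒢.stableLetter e)⁻¹ *
        (𝒢.vertexIncl (𝒢.src e) (𝒢.srcHom e x))⁻¹} ∪
  𝒢.stableLetter '' T

/-- The fundamental group of the graph of groups with respect to the spanning tree `T`. -/
abbrev FundamentalGroup (T : Set E) : Type _ :=
  𝒢.BigFreeProduct ⧸ Subgroup.normalClosure (𝒢.relators T)

end GraphOfGroups

/-! With trivial edge groups every relator is either trivial or a stable letter of `T`, so the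
fundamental group is the free product of the vertex groups and of one infinite cyclic group for each
edge outside `T`. Only the embedding into this free product is needed (`ofFactors_toFactors`), since
an injective homomorphism does not change which words are trivial. A counter solves the word problem
of the cyclic factors in linear time, so the matter is the word problem of a finite free product
(`wordProblemInTime_coprodI`).

It is solved by divide and conquer. Every input letter is replaced by a fixed reduced word, a list
of nontrivial syllables from alternating factors. A pass multiplies neighbouring words `p`, `q` in
pairs. As both are reduced, cancellation occurs only at the seam: if the last syllable of `p` and
the first of `q` lie in the same factor, the machine of that factor tests their product. If it is
trivial, both syllables are erased and the seam meets the next two; if not, they fuse and the result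
is reduced. Hence a letter takes part in at most one test per pass (`reach_cancel`), and if `W` is
superadditive and dominates the running times of the factors, all the tests of a pass over a string
of length `n` together cost at most `W n`, up to constants (`reach_pass`). The number of words
halves in each pass, which gives the logarithm (`reach_rounds`). The last word is reduced, so by the
normal form theorem it is trivial only if it is empty.

Convexity supplies `W`: a convex function that vanishes at `0` is superadditive
(`NatConvex.exists_superadditive`). The machine is written with stacks, which a multi-tape Turing
machine simulates with two steps for one. -/

/-! ## Reachability in a bounded number of steps -/

/-- `b` is reached from `a` in at most `n` steps. -/
def ReachIn {σ : Type*} (step : σ → Option σ) (n : ℕ) (a b : σ) : Prop :=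
  ∃ k ≤ n, (flip bind step)^[k] (some a) = some b

namespace ReachIn

variable {σ : Type*} {step : σ → Option σ} {n m : ℕ} {a b c : σ}

theorem refl : ReachIn step 0 a a := ⟨0, le_rfl, rfl⟩

theorem mono (h : ReachIn step n a b) (hnm : n ≤ m) : ReachIn step m a b :=
  let ⟨k, hk, e⟩ := h
  ⟨k, hk.trans hnm, e⟩

theorem trans (h₁ : ReachIn step n a b) (h₂ : ReachIn step m b c) : ReachIn step (n + m) a c := by
  obtain ⟨k, hk, e⟩ := h₁
  obtain ⟨l, hl, e'⟩ := h₂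
  exact ⟨l + k, by omega, by rw [Function.iterate_add_apply, e, e']⟩

theorem single (h : step a = some b) : ReachIn step 1 a b := ⟨1, le_rfl, h⟩

theorem head (h : step a = some b) (h' : ReachIn step n b c) : ReachIn step (n + 1) a c :=
  ((single h).trans h').mono (by omega)

theorem tail (h : ReachIn step n a b) (h' : step b = some c) : ReachIn step (n + 1) a c :=
  h.trans (single h')

theorem of_evalsToInTime (h : Nonempty (StateTransition.EvalsToInTime step a (some b) n)) :
    ReachIn step n a b :=
  let ⟨h⟩ := h
  ⟨h.steps, h.steps_le_m, h.evals_in_steps⟩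

theorem evalsToInTime (h : ReachIn step n a b) :
    Nonempty (StateTransition.EvalsToInTime step a (some b) n) :=
  let ⟨k, hk, e⟩ := h
  ⟨⟨⟨k, e⟩, hk⟩⟩

/-- A simulation relation that is preserved by every step, at the cost of `d` steps. -/
theorem simulate {τ : Type*} {step' : τ → Option τ} {d : ℕ} (R : ℕ → σ → τ → Prop)
    (hR : ∀ k a b a', R k a a' → step a = some b → ∃ b', ReachIn step' d a' b' ∧ R (k + 1) b b')
    (h : ReachIn step n a b) {a' : τ} (ha : R 0 a a') :
    ∃ k ≤ n, ∃ b', ReachIn step' (d * k) a' b' ∧ R k b b' := by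
  obtain ⟨k, hk, e⟩ := h
  refine ⟨k, hk, ?_⟩
  clear hk
  induction k generalizing b with
  | zero =>
    obtain rfl : a = b := by simpa using e
    exact ⟨a', refl, ha⟩
  | succ k ih =>
    rw [Function.iterate_succ_apply'] at e
    obtain ⟨c, hc, e⟩ := Option.bind_eq_some_iff.1 e
    obtain ⟨c', h1, h2⟩ := ih hc
    obtain ⟨b', h3, h4⟩ := hR _ _ _ _ h2 e
    exact ⟨b', (h1.trans h3).mono (by rw [Nat.mul_succ]), h4⟩

end ReachIn

/-! ## Multi-stack machines -/

/-- The operations of a multi-stack machine on a stack. -/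
inductive StackOp (Γ : Type) : Type
  | keep
  | pop
  | set (a : Γ)
  | push (a : Γ)
  | set₂ (b a : Γ)

namespace StackOp

variable {Γ : Type}

/-- The effect of an operation; `set` and `set₂` replace the top element. -/
def apply : StackOp Γ → List Γ → List Γ
  | keep, l => l
  | pop, l => l.tail
  | set a, l => a :: l.tail
  | push a, l => a :: l
  | set₂ b a, l => b :: a :: l.tail

@[simp] theorem apply_keep (l : List Γ) : apply keep l = l := rfl
@[simp] theorem apply_pop (l : List Γ) : apply pop l = l.tail := rfl
@[simp] theorem apply_set (a : Γ) (l : List Γ) : apply (set a) l = a :: l.tail := rfl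
@[simp] theorem apply_push (a : Γ) (l : List Γ) : apply (push a) l = a :: l := rfl
@[simp] theorem apply_set₂ (b a : Γ) (l : List Γ) : apply (set₂ b a) l = b :: a :: l.tail := rfl

instance [Finite Γ] : Finite (StackOp Γ) := by
  let g : Option Unit ⊕ Γ ⊕ Γ ⊕ Γ × Γ → StackOp Γ
    | .inl none => keep
    | .inl (some _) => pop
    | .inr (.inl a) => set a
    | .inr (.inr (.inl a)) => push a
    | .inr (.inr (.inr p)) => set₂ p.1 p.2
  refine Finite.of_surjective g ?_
  rintro (_ | _ | a | a | ⟨b, a⟩)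
  exacts [⟨.inl none, rfl⟩, ⟨.inl (some ()), rfl⟩, ⟨.inr (.inl a), rfl⟩, ⟨.inr (.inr (.inl a)), rfl⟩,
    ⟨.inr (.inr (.inr (b, a))), rfl⟩]

/-- The first half of the simulation of an operation by a tape whose head scans `h`. -/
def first {Δ : Type} (ι : Γ → Δ) (h : Option Δ) : StackOp Γ → Option Δ × Option Turing.Dir
  | keep => (h, none)
  -- The popped cell is blanked because it ends up to the left of the head, where `stackTape` is
  -- blank.
  | pop => (none, some .right)
  | set a => (some (ι a), none)
  | push _ => (h, some .left)
  | set₂ _ a => (some (ι a), some .left)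

/-- The second half of the simulation of an operation by a tape whose head scans `h`. -/
def second {Δ : Type} (ι : Γ → Δ) (h : Option Δ) : StackOp Γ → Option Δ × Option Turing.Dir
  | push a => (some (ι a), none)
  | set₂ b _ => (some (ι b), none)
  | _ => (h, none)

end StackOp

/-- The tape that represents a stack: its top is scanned, the rest lies to the right. -/
def stackTape {Γ Δ : Type} (ι : Γ → Δ) (l : List Γ) : Turing.Tape (Option Δ) :=
  Turing.Tape.mk₁ (l.map fun a => some (ι a))

theorem stackTape_eq {Γ Δ : Type} (ι : Γ → Δ) (l : List Γ) :
    stackTape ι l = Turing.Tape.mk' (Turing.ListBlank.mk [])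
      (Turing.ListBlank.mk (l.map fun a => some (ι a))) := rfl

theorem stackTape_head {Γ Δ : Type} (ι : Γ → Δ) (l : List Γ) :
    (stackTape ι l).head = l.head?.map ι := by
  cases l <;> rfl

theorem mk_headI_tail {Δ : Type} (l : List (Option Δ)) :
    Turing.ListBlank.mk (l.headI :: l.tail) = Turing.ListBlank.mk l :=
  Turing.ListBlank.cons_head_tail (Turing.ListBlank.mk l)

theorem mk_blank_singleton {Δ : Type} :
    Turing.ListBlank.mk [(none : Option Δ)] = Turing.ListBlank.mk [] := by
  ext i
  cases i <;> rfl

/-- A head writes before it moves, whereas a push has to move before it writes; hence two tape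
actions for each stack operation. -/
theorem actOn_second_first {Γ Δ : Type} (ι : Γ → Δ) (l : List Γ) (o : StackOp Γ) :
    let t := MultiTapeTM.actOn (stackTape ι l) (o.first ι (stackTape ι l).head)
    MultiTapeTM.actOn t (o.second ι t.head) = stackTape ι (o.apply l) := by
  cases o <;> simp [StackOp.first, StackOp.second, MultiTapeTM.actOn, StackOp.apply,
    stackTape_eq, mk_headI_tail, mk_blank_singleton]

/-- A deterministic machine with finitely many stacks, one of which holds the input. -/
structure StackMachine (α : Type) where
  Stacks : Type
  Symbol : Stacks → Type
  State : Type
  finiteStacks : Finite Stacks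
  finiteSymbol : ∀ k, Finite (Symbol k)
  finiteState : Finite State
  inputStack : Stacks
  letter : α ↪ Symbol inputStack
  start : State
  accepting : Set State
  transition : State → (∀ k, Option (Symbol k)) → Option (State × ∀ k, StackOp (Symbol k))

namespace StackMachine

variable {α : Type} (S : StackMachine α)

/-- The configurations of a stack machine. -/
abbrev Cfg : Type := S.State × ∀ k, List (S.Symbol k)

/-- One step of a stack machine. -/
def step (c : S.Cfg) : Option S.Cfg :=
  (S.transition c.1 fun k => (c.2 k).head?).map fun a => (a.1, fun k => (a.2 k).apply (c.2 k))

open scoped Classical in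
/-- The initial configuration on a given input. -/
noncomputable def init (w : List α) : S.Cfg :=
  (S.start, Function.update (fun _ => []) S.inputStack (w.map S.letter))

/-- The stack machine decides a language in a given time. -/
def DecidesInTime (L : Set (List α)) (t : ℕ → ℕ) : Prop :=
  ∀ w : List α, ∃ c : S.Cfg, ReachIn S.step (t w.length) (S.init w) c ∧ S.step c = none ∧
    (c.1 ∈ S.accepting ↔ w ∈ L)

open scoped Classical in
/-- Reading a symbol of the stack `k` on the corresponding tape. -/
noncomputable def decode (k : S.Stacks) (o : Option (Σ k, S.Symbol k)) : Option (S.Symbol k) :=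
  o.bind fun p => if h : p.1 = k then some (h ▸ p.2) else none

@[simp]
theorem decode_map_mk (k : S.Stacks) (o : Option (S.Symbol k)) :
    S.decode k (o.map (Sigma.mk k)) = o := by
  cases o <;> simp [decode]

/-- The multi-tape Turing machine that simulates a stack machine, each step in two steps. -/
noncomputable def toTM : MultiTapeTM α where
  Tapes := S.Stacks
  Symbol := Σ k, S.Symbol k
  -- The right summand remembers an action whose second half is still to be performed.
  State := S.State ⊕ S.State × ∀ k, StackOp (S.Symbol k)
  finiteTapes := S.finiteStacks
  finiteSymbol := by
    have := S.finiteStacks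
    have := S.finiteSymbol
    infer_instance
  finiteState := by
    have := S.finiteStacks
    have := S.finiteSymbol
    have := S.finiteState
    infer_instance
  inputTape := S.inputStack
  letter := S.letter.trans (Function.Embedding.sigmaMk S.inputStack)
  start := .inl S.start
  accepting := Sum.inl '' S.accepting
  transition
    | .inl q, h => (S.transition q fun k => S.decode k (h k)).map fun a =>
        (.inr a, fun k => (a.2 k).first (Sigma.mk k) (h k))
    | .inr a, h => some (.inl a.1, fun k => (a.2 k).second (Sigma.mk k) (h k))

/-- The configuration of the simulating Turing machine. -/
noncomputable def toTMCfg (c : S.Cfg) : S.toTM.Cfg where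
  state := .inl c.1
  tape k := stackTape (Sigma.mk (show S.Stacks from k)) (c.2 k)

theorem toTM_transition_inl (c : S.Cfg) :
    S.toTM.transition (.inl c.1) (fun k => ((S.toTMCfg c).tape k).head) =
      (S.transition c.1 fun k => (c.2 k).head?).map fun a => (.inr a, fun k =>
        (a.2 k).first (Sigma.mk (show S.Stacks from k)) ((S.toTMCfg c).tape k).head) := by
  have : (fun k => S.decode k ((S.toTMCfg c).tape k).head) = fun k => (c.2 k).head? := by
    funext k
    exact (congrArg (S.decode k) (stackTape_head (Sigma.mk k) (c.2 k))).trans (S.decode_map_mk k _)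
  change Option.map _ (S.transition c.1 fun k => S.decode k ((S.toTMCfg c).tape k).head) = _
  rw [this]
  rfl

theorem toTM_step_none (c : S.Cfg) (h : S.step c = none) : S.toTM.step (S.toTMCfg c) = none := by
  rw [step, Option.map_eq_none_iff] at h
  rw [MultiTapeTM.step, Option.map_eq_none_iff]
  refine (S.toTM_transition_inl c).trans ?_
  rw [h]
  rfl

theorem toTM_step (c d : S.Cfg) (h : S.step c = some d) :
    ReachIn S.toTM.step 2 (S.toTMCfg c) (S.toTMCfg d) := by
  obtain ⟨a, ha, rfl⟩ := Option.map_eq_some_iff.1 h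
  have h1 : S.toTM.step (S.toTMCfg c) = some ⟨.inr a, fun k => MultiTapeTM.actOn
      ((S.toTMCfg c).tape k)
      ((a.2 k).first (Sigma.mk (show S.Stacks from k)) ((S.toTMCfg c).tape k).head)⟩ := by
    rw [MultiTapeTM.step, show (S.toTMCfg c).state = .inl c.1 from rfl]
    rw [S.toTM_transition_inl c, ha]
    rfl
  refine .head h1 (.single ?_)
  change some _ = some _
  congr 1
  simp only [toTMCfg]
  congr 1
  funext k
  exact actOn_second_first _ _ _

theorem toTMCfg_init (w : List α) : S.toTMCfg (S.init w) = S.toTM.init w := by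
  classical
  simp only [toTMCfg, init, MultiTapeTM.init]
  congr 1
  funext k
  by_cases hk : k = S.inputStack
  · subst hk
    refine Eq.trans ?_ (if_pos rfl).symm
    rw [Function.update_self]
    exact congrArg Turing.Tape.mk₁ List.map_map
  · refine Eq.trans ?_ (if_neg hk).symm
    have key (j : S.Stacks) (hj : j ≠ S.inputStack) :
        stackTape (Sigma.mk j) (Function.update (fun _ => []) S.inputStack (w.map S.letter) j) =
          Turing.Tape.mk₁ [] := by
      rw [Function.update_of_ne hj]
      rfl
    exact key k hk

theorem toTM_decidesInTime {L : Set (List α)} {t : ℕ → ℕ} (h : S.DecidesInTime L t) :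
    S.toTM.DecidesInTime L (fun n => 2 * t n) := by
  intro w
  obtain ⟨c, h1, h2, h3⟩ := h w
  refine ⟨S.toTMCfg c, ?_, S.toTM_step_none c h2, ?_⟩
  · obtain ⟨k, hk, b, hb, rfl⟩ := h1.simulate (fun _ a b => b = S.toTMCfg a)
      (fun k a b a' e hs => ⟨_, e ▸ S.toTM_step a b hs, rfl⟩) rfl
    rw [← toTMCfg_init]
    exact (hb.mono (Nat.mul_le_mul_left 2 hk)).evalsToInTime
  · rw [← h3]
    exact Sum.inl_injective.mem_set_image

end StackMachine

/-! ## The machine for free products -/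

/-- The stacks of the free product machine: the input, the part of the string to the left of the
current position, the part to its right, a stack for saved letters, and two stacks for each tape of
each of the machines of the factors (`true` for the scanned cell and the cells to its right). -/
inductive FPStack {I : Type} {α : I → Type} (M : ∀ i, MultiTapeTM (α i)) : Type
  | input
  | left
  | right
  | save
  | sub (i : I) (k : (M i).Tapes) (side : Bool)

/-- The states of the free product machine. -/
inductive FPState {I : Type} {α : I → Type} (M : ∀ i, MultiTapeTM (α i)) (N : ℕ) : Type
  | load (l : {l : List (Option (Σ i, α i)) // l.length ≤ N})
  | rewind
  | shift (keep removed : Bool)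
  | cancel
  | gatherRight (i : I)
  | gatherLeft (i : I)
  | run (i : I) (q : (M i).State)
  | clean (acc : Bool)
  | discard
  | restore
  | done (acc : Bool)

namespace FreeProductMachine

variable {I : Type} {α : I → Type} (M : ∀ i, MultiTapeTM (α i)) (X : Type)

instance [Finite I] : Finite (FPStack M) := by
  have := fun i => (M i).finiteTapes
  let g : Bool × Bool ⊕ (Σ i, (M i).Tapes × Bool) → FPStack M
    | .inl (true, true) => .input
    | .inl (true, false) => .left
    | .inl (false, true) => .right
    | .inl (false, false) => .save
    | .inr p => .sub p.1 p.2.1 p.2.2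
  refine Finite.of_surjective g ?_
  rintro (_ | _ | _ | _ | ⟨i, k, s⟩)
  exacts [⟨.inl (true, true), rfl⟩, ⟨.inl (true, false), rfl⟩, ⟨.inl (false, true), rfl⟩,
    ⟨.inl (false, false), rfl⟩, ⟨.inr ⟨i, k, s⟩, rfl⟩]

instance (N : ℕ) [Finite I] [∀ i, Finite (α i)] : Finite (FPState M N) := by
  have := fun i => (M i).finiteState
  have : Finite {l : List (Option (Σ i, α i)) // l.length ≤ N} := List.finite_length_le _ N
  let g : {l : List (Option (Σ i, α i)) // l.length ≤ N} ⊕ Bool × Bool ⊕ I ⊕ I ⊕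
      (Σ i, (M i).State) ⊕ Bool ⊕ Bool ⊕ Bool × Bool → FPState M N
    | .inl l => .load l
    | .inr (.inl p) => .shift p.1 p.2
    | .inr (.inr (.inl i)) => .gatherRight i
    | .inr (.inr (.inr (.inl i))) => .gatherLeft i
    | .inr (.inr (.inr (.inr (.inl p)))) => .run p.1 p.2
    | .inr (.inr (.inr (.inr (.inr (.inl b))))) => .clean b
    | .inr (.inr (.inr (.inr (.inr (.inr (.inl b)))))) => .done b
    | .inr (.inr (.inr (.inr (.inr (.inr (.inr (true, true))))))) => .rewind
    | .inr (.inr (.inr (.inr (.inr (.inr (.inr (true, false))))))) => .cancel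
    | .inr (.inr (.inr (.inr (.inr (.inr (.inr (false, true))))))) => .discard
    | .inr (.inr (.inr (.inr (.inr (.inr (.inr (false, false))))))) => .restore
  refine Finite.of_surjective g ?_
  rintro (l | _ | ⟨a, b⟩ | _ | i | i | ⟨i, q⟩ | b | _ | _ | b)
  exacts [⟨.inl l, rfl⟩, ⟨.inr (.inr (.inr (.inr (.inr (.inr (.inr (true, true))))))), rfl⟩,
    ⟨.inr (.inl (a, b)), rfl⟩, ⟨.inr (.inr (.inr (.inr (.inr (.inr (.inr (true, false))))))), rfl⟩,
    ⟨.inr (.inr (.inl i)), rfl⟩, ⟨.inr (.inr (.inr (.inl i))), rfl⟩,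
    ⟨.inr (.inr (.inr (.inr (.inl ⟨i, q⟩)))), rfl⟩, ⟨.inr (.inr (.inr (.inr (.inr (.inl b))))), rfl⟩,
    ⟨.inr (.inr (.inr (.inr (.inr (.inr (.inr (false, true))))))), rfl⟩,
    ⟨.inr (.inr (.inr (.inr (.inr (.inr (.inr (false, false))))))), rfl⟩,
    ⟨.inr (.inr (.inr (.inr (.inr (.inr (.inl b)))))), rfl⟩]

/-- The alphabets of the stacks. -/
def Sym : FPStack M → Type
  | .input => X
  | .left => Option (Σ i, α i)
  | .right => Option (Σ i, α i)
  | .save => Option (Σ i, α i)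
  | .sub i _ _ => Option (M i).Symbol

instance [Finite X] [Finite I] [∀ i, Finite (α i)] (k : FPStack M) : Finite (Sym M X k) := by
  have := fun i => (M i).finiteSymbol
  cases k <;> simp only [Sym] <;> infer_instance

variable {M X}

/-- A family of objects, one for each stack. -/
def fam {F : Type → Type} (inp : F X) (l r s : F (Option (Σ i, α i)))
    (sub : ∀ i, (M i).Tapes → Bool → F (Option (M i).Symbol)) : ∀ k, F (Sym M X k)
  | .input => inp
  | .left => l
  | .right => r
  | .save => s
  | .sub i k b => sub i k b

/-- The simulation of an action of a tape by two stacks; `a` is the content of the cell to the left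
of the scanned one. -/
def simOp {Γ : Type} (a : Option Γ) (b : Option Γ × Option Turing.Dir) : Bool → StackOp (Option Γ)
  | true => match b.2 with
    | none => .set b.1
    -- The scanned cell is overwritten, and the cell that the other stack loses becomes the new top.
    | some .left => .set₂ a b.1
    | some .right => .pop
  | false => match b.2 with
    | none => .keep
    | some .left => .pop
    | some .right => .push b.1

/-- No operation on the stacks of the machines of the factors. -/
def noSub : ∀ i, (M i).Tapes → Bool → StackOp (Option (M i).Symbol) := fun _ _ _ => .keep

open scoped Classical in
/-- The operations that write a letter in front of the input of the machine of a factor. -/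
noncomputable def pushSub (a : Σ i, α i) :
    ∀ i, (M i).Tapes → Bool → StackOp (Option (M i).Symbol) :=
  Function.update noSub a.1 fun k b =>
    if k = (M a.1).inputTape ∧ b = true then .push (some ((M a.1).letter a.2)) else .keep

variable (M) in
open scoped Classical in
/-- The transition function of the free product machine. -/
noncomputable def transition {N : ℕ} (code : X → {l : List (Option (Σ i, α i)) // l.length ≤ N}) :
    FPState M N → (∀ k, Option (Sym M X k)) → Option (FPState M N × ∀ k, StackOp (Sym M X k))
  | .load ⟨[], _⟩, h => match h .input with
    | none => some (.rewind, fam .keep .keep .keep .keep noSub)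
    | some x => some (.load (code x), fam .pop .keep .keep .keep noSub)
  | .load ⟨a :: l, hl⟩, _ =>
    some (.load ⟨l, (Nat.le_succ _).trans hl⟩, fam .keep (.push a) .keep .keep noSub)
  | .rewind, h => match h .left with
    | none => some (.shift true false, fam .keep .keep .keep .keep noSub)
    | some a => some (.rewind, fam .keep .pop (.push a) .keep noSub)
  -- `keep` tells whether the next separator opens a pair and stays, or lies at a seam and goes.
  -- `removed` records that some seam was met in this pass; if none was, at most one word is left
  -- and the top of the left stack gives the answer.
  | .shift keep removed, h => match h .right with
    | none => if removed then some (.rewind, fam .keep .keep .keep .keep noSub)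
        else some (.done (match h .left with
          | some (some _) => false
          | _ => true), fam .keep .keep .keep .keep noSub)
    | some (some a) => some (.shift keep removed, fam .keep (.push (some a)) .pop .keep noSub)
    | some none =>
      if keep then some (.shift false removed, fam .keep (.push none) .pop .keep noSub)
      else some (.cancel, fam .keep .keep .pop .keep noSub)
  | .cancel, h => match h .left, h .right with
    | some (some a), some (some b) =>
      if a.1 = b.1 then some (.gatherRight a.1, fam .keep .keep .keep .keep noSub)
      else some (.shift true true, fam .keep .keep .keep .keep noSub)
    | _, _ => some (.shift true true, fam .keep .keep .keep .keep noSub)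
  | .gatherRight i, h => match h .right with
    | some (some a) =>
      if a.1 = i then some (.gatherRight i, fam .keep (.push (some a)) .pop .keep noSub)
      else some (.gatherLeft i, fam .keep .keep .keep .keep noSub)
    | _ => some (.gatherLeft i, fam .keep .keep .keep .keep noSub)
  | .gatherLeft i, h => match h .left with
    | some (some a) =>
      if a.1 = i then some (.gatherLeft i, fam .keep .pop .keep (.push (some a)) (pushSub a))
      else some (.run i (M i).start, fam .keep .keep .keep .keep noSub)
    | _ => some (.run i (M i).start, fam .keep .keep .keep .keep noSub)
  | .run i q, h => match (M i).transition q fun k => (h (.sub i k true)).join with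
    | none => some (.clean (decide (q ∈ (M i).accepting)), fam .keep .keep .keep .keep noSub)
    | some a => some (.run i a.1, fam .keep .keep .keep .keep
        (Function.update noSub i fun k => simOp (h (.sub i k false)).join (a.2 k)))
  -- All stacks are popped at once, harmlessly where they are already empty, so the time is governed
  -- by the longest one.
  | .clean acc, h =>
    if ∀ i k b, h (.sub i k b) = none then
      some (if acc then .discard else .restore, fam .keep .keep .keep .keep noSub)
    else some (.clean acc, fam .keep .keep .keep .keep fun _ _ _ => .pop)
  | .discard, h => match h .save with
    | none => some (.cancel, fam .keep .keep .keep .keep noSub)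
    | some _ => some (.discard, fam .keep .keep .keep .pop noSub)
  | .restore, h => match h .save with
    | none => some (.shift true true, fam .keep .keep .keep .keep noSub)
    | some a => some (.restore, fam .keep (.push a) .keep .pop noSub)
  | .done _, _ => none

variable (M) in
/-- The free product machine. -/
noncomputable def machine [Finite I] [∀ i, Finite (α i)] [Finite X] {N : ℕ}
    (code : X → {l : List (Option (Σ i, α i)) // l.length ≤ N}) : StackMachine X where
  Stacks := FPStack M
  Symbol := Sym M X
  State := FPState M N
  finiteStacks := inferInstance
  finiteSymbol := inferInstance
  finiteState := inferInstance
  inputStack := .input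
  letter := Function.Embedding.refl X
  start := .load ⟨[], Nat.zero_le _⟩
  accepting := {.done true}
  transition := transition M code

variable (M) in
/-- The contents of the stacks of the machines of the factors. -/
abbrev Sub : Type := ∀ i, (M i).Tapes → Bool → List (Option (M i).Symbol)

/-- Empty stacks for the machines of the factors. -/
def Sub.empty : Sub M := fun _ _ _ => []

open scoped Classical in
/-- The stacks of the machine of the factor `i` in its initial configuration. -/
noncomputable def Sub.ofInput {i : I} (w : List (α i)) : Sub M :=
  Function.update Sub.empty i fun k b =>
    if k = (M i).inputTape ∧ b = true then w.map fun a => some ((M i).letter a) else []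

theorem Sub.ofInput_nil (i : I) : Sub.ofInput ([] : List (α i)) = (Sub.empty : Sub M) := by
  classical
  simp only [ofInput, List.map_nil, ite_self]
  exact Function.update_eq_self i Sub.empty

theorem pushSub_apply {i : I} (a : α i) (w : List (α i)) :
    (fun j k b => (pushSub (M := M) ⟨i, a⟩ j k b).apply (Sub.ofInput w j k b)) =
      Sub.ofInput (a :: w) := by
  classical
  funext j k b
  by_cases hj : j = i
  · subst hj
    simp only [pushSub, Sub.ofInput, Function.update_self]
    split_ifs <;> simp
  · simp [pushSub, Sub.ofInput, Function.update_of_ne hj, noSub]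

/-! ### The elementary phases of the free product machine -/

variable [Finite I] [∀ i, Finite (α i)] [Finite X] {N : ℕ}
  (code : X → {l : List (Option (Σ i, α i)) // l.length ≤ N})

/-- Configurations of the free product machine. -/
def cfg (q : FPState M N) (inp : List X) (l r s : List (Option (Σ i, α i))) (sub : Sub M) :
    (machine M code).Cfg :=
  (q, fam inp l r s sub)

variable {inp : List X} {l r s : List (Option (Σ i, α i))} {sub : Sub M}

variable {code} in
theorem step_cfg {q q' : FPState M N} {inp' : List X} {l' r' s' : List (Option (Σ i, α i))}
    {sub' : Sub M} {a b c d e}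
    (h : transition M code q (fam inp.head? l.head? r.head? s.head? fun i k b => (sub i k b).head?)
      = some (q', fam a b c d e))
    (hi : a.apply inp = inp') (hl : b.apply l = l') (hr : c.apply r = r') (hs : d.apply s = s')
    (hsub : (fun i k b => (e i k b).apply (sub i k b)) = sub') :
    (machine M code).step (cfg code q inp l r s sub) = some (cfg code q' inp' l' r' s' sub') := by
  have h1 : (fun k => (fam inp l r s sub k : List (Sym M X k)).head?) =
      fam inp.head? l.head? r.head? s.head? fun i k b => (sub i k b).head? := by
    funext k
    cases k <;> rfl
  subst hi hl hr hs hsub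
  change Option.map _ (transition M code q
    (fun k => (fam inp l r s sub k : List (Sym M X k)).head?)) = _
  rw [h1, h]
  change some (_, _) = some (_, _)
  congr 2
  funext k
  cases k <;> rfl

variable {code} in
theorem step_cfg_stay {q q' : FPState M N}
    (h : transition M code q (fam inp.head? l.head? r.head? s.head? fun i k b => (sub i k b).head?)
      = some (q', fam .keep .keep .keep .keep noSub)) :
    (machine M code).step (cfg code q inp l r s sub) = some (cfg code q' inp l r s sub) :=
  step_cfg h rfl rfl rfl rfl rfl

/-- A configuration of the free product machine is reached in a bounded number of steps. -/
abbrev Reach (n : ℕ) (c d : (machine M code).Cfg) : Prop := ReachIn (machine M code).step n c d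

theorem reach_load_word (u : List (Option (Σ i, α i))) (hu : u.length ≤ N) :
    Reach code u.length (cfg code (.load ⟨u, hu⟩) inp l r s sub)
      (cfg code (.load ⟨[], Nat.zero_le _⟩) inp (u.reverse ++ l) r s sub) := by
  induction u generalizing l with
  | nil => exact .refl
  | cons a u ih =>
    have hu' : u.length ≤ N := (Nat.le_succ _).trans hu
    have h : (machine M code).step (cfg code (.load ⟨a :: u, hu⟩) inp l r s sub) =
        some (cfg code (.load ⟨u, hu'⟩) inp (a :: l) r s sub) := step_cfg rfl rfl rfl rfl rfl rfl
    simpa using ReachIn.head h (ih hu')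

theorem reach_load (w : List X) :
    Reach code (w.length * (N + 1) + 1) (cfg code (.load ⟨[], Nat.zero_le _⟩) w l r s sub)
      (cfg code .rewind [] ((w.flatMap fun x => (code x).1).reverse ++ l) r s sub) := by
  induction w generalizing l with
  | nil => exact (ReachIn.single (step_cfg_stay rfl)).mono (by simp)
  | cons x w ih =>
    have h : (machine M code).step (cfg code (.load ⟨[], Nat.zero_le _⟩) (x :: w) l r s sub) =
        some (cfg code (.load (code x)) w l r s sub) := step_cfg rfl rfl rfl rfl rfl rfl
    have h2 := ReachIn.head h
      ((reach_load_word code _ (code x).2).trans (ih (l := (code x).1.reverse ++ l)))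
    simp only [List.flatMap_cons, List.reverse_append, List.append_assoc, List.length_cons]
    refine h2.mono ?_
    have := (code x).2
    rw [Nat.add_mul]
    omega

theorem reach_rewind :
    Reach code (l.length + 1) (cfg code .rewind inp l r s sub)
      (cfg code (.shift true false) inp [] (l.reverse ++ r) s sub) := by
  induction l generalizing r with
  | nil => exact .single (step_cfg_stay rfl)
  | cons a l ih =>
    have h : (machine M code).step (cfg code .rewind inp (a :: l) r s sub) =
        some (cfg code .rewind inp l (a :: r) s sub) := step_cfg rfl rfl rfl rfl rfl rfl
    simpa using ReachIn.head h ih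

theorem reach_shift_letters (b c : Bool) (u : List (Σ i, α i)) :
    Reach code u.length (cfg code (.shift b c) inp l (u.map some ++ r) s sub)
      (cfg code (.shift b c) inp ((u.map some).reverse ++ l) r s sub) := by
  induction u generalizing l with
  | nil => exact .refl
  | cons a u ih =>
    have h : (machine M code).step
        (cfg code (.shift b c) inp l (some a :: (u.map some ++ r)) s sub) =
        some (cfg code (.shift b c) inp (some a :: l) (u.map some ++ r) s sub) :=
      step_cfg rfl rfl rfl rfl rfl rfl
    simpa using ReachIn.head h ih

/-- The top of the stack is not a letter of the factor `i`. -/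
def TopNe (i : I) (l : List (Option (Σ i, α i))) : Prop :=
  ∀ a : Σ i, α i, l.head? = some (some a) → a.1 ≠ i

/-- The letters of a word in the generators of a factor. -/
def letters (i : I) (u : List (α i)) : List (Option (Σ i, α i)) := u.map fun a => some ⟨i, a⟩

/-- The hypothesis on `r` makes the gathering stop exactly at the end of the syllable. -/
theorem reach_gatherRight {i : I} (u : List (α i)) (hr : TopNe i r) :
    Reach code (u.length + 1) (cfg code (.gatherRight i) inp l (letters i u ++ r) s sub)
      (cfg code (.gatherLeft i) inp ((letters i u).reverse ++ l) r s sub) := by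
  induction u generalizing l with
  | nil =>
    refine .single (step_cfg_stay ?_)
    rcases r with - | ⟨- | a, r⟩
    · rfl
    · rfl
    · exact if_neg (hr a rfl)
  | cons a u ih =>
    have h : (machine M code).step
        (cfg code (.gatherRight i) inp l (some ⟨i, a⟩ :: (letters i u ++ r)) s sub) =
        some (cfg code (.gatherRight i) inp (some ⟨i, a⟩ :: l) (letters i u ++ r) s sub) :=
      step_cfg (if_pos rfl) rfl rfl rfl rfl rfl
    simpa [letters] using ReachIn.head h ih

/-- Letters leave the left stack last one first, so pushing them restores the reading order, both on
the input tape of the factor and in the saved copy. The word `w` is the part already transferred, as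
the induction requires. -/
theorem reach_gatherLeft {i : I} (u w : List (α i)) (hl : TopNe i l) :
    Reach code (u.length + 1)
      (cfg code (.gatherLeft i) inp ((letters i u).reverse ++ l) r s (Sub.ofInput w))
      (cfg code (.run i (M i).start) inp l r (letters i u ++ s) (Sub.ofInput (u ++ w))) := by
  induction u using List.reverseRecOn generalizing w s with
  | nil =>
    refine .single (step_cfg_stay ?_)
    rcases l with - | ⟨- | a, l⟩
    · rfl
    · rfl
    · exact if_neg (hl a rfl)
  | append_singleton u a ih =>
    have h : (machine M code).step (cfg code (.gatherLeft i) inp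
          (some ⟨i, a⟩ :: ((letters i u).reverse ++ l)) r s (Sub.ofInput w)) =
        some (cfg code (.gatherLeft i) inp ((letters i u).reverse ++ l) r
          (some ⟨i, a⟩ :: s) (Sub.ofInput (a :: w))) :=
      step_cfg (if_pos rfl) rfl rfl rfl rfl (pushSub_apply a w)
    simpa [letters] using ReachIn.head h (ih (w := a :: w) (s := some ⟨i, a⟩ :: s))

theorem reach_clean (acc : Bool) (n : ℕ) (h : ∀ i k b, (sub i k b).length ≤ n) :
    Reach code (n + 1) (cfg code (.clean acc) inp l r s sub)
      (cfg code (if acc then .discard else .restore) inp l r s Sub.empty) := by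
  induction n generalizing sub with
  | zero =>
    obtain rfl : sub = Sub.empty := by
      funext i k b
      exact List.length_eq_zero_iff.1 (Nat.le_zero.1 (h i k b))
    exact .single (step_cfg_stay (if_pos fun _ _ _ => rfl))
  | succ n ih =>
    by_cases h0 : ∀ i k b, (sub i k b).head? = none
    · obtain rfl : sub = Sub.empty := by
        funext i k b
        exact List.head?_eq_none_iff.1 (h0 i k b)
      exact ReachIn.mono (n := 1) (.single (step_cfg_stay (if_pos fun _ _ _ => rfl))) (by omega)
    · have h1 : (machine M code).step (cfg code (.clean acc) inp l r s sub) =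
          some (cfg code (.clean acc) inp l r s fun i k b => (sub i k b).tail) :=
        step_cfg (if_neg h0) rfl rfl rfl rfl rfl
      refine .head h1 (ih fun i k b => ?_)
      simpa using h i k b

theorem reach_discard :
    Reach code (s.length + 1) (cfg code .discard inp l r s sub)
      (cfg code .cancel inp l r [] sub) := by
  induction s with
  | nil => exact .single (step_cfg_stay rfl)
  | cons a s ih =>
    have h : (machine M code).step (cfg code .discard inp l r (a :: s) sub) =
        some (cfg code .discard inp l r s sub) := step_cfg rfl rfl rfl rfl rfl rfl
    exact .head h ih

theorem reach_restore :
    Reach code (s.length + 1) (cfg code .restore inp l r s sub)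
      (cfg code (.shift true true) inp (s.reverse ++ l) r [] sub) := by
  induction s generalizing l with
  | nil => exact .single (step_cfg_stay rfl)
  | cons a s ih =>
    have h : (machine M code).step (cfg code .restore inp l r (a :: s) sub) =
        some (cfg code .restore inp (a :: l) r s sub) := step_cfg rfl rfl rfl rfl rfl rfl
    simpa using ReachIn.head h ih

end FreeProductMachine

/-! ### Running the machine of a factor on pairs of stacks -/

namespace FreeProductMachine

variable {I : Type} {α : I → Type} {M : ∀ i, MultiTapeTM (α i)} {X : Type}

theorem headI_eq_join {Γ : Type} (l : List (Option Γ)) : l.headI = l.head?.join := by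
  cases l <;> rfl

theorem actOn_mk' {Γ : Type} (l r : List (Option Γ)) (b : Option Γ × Option Turing.Dir) :
    MultiTapeTM.actOn (Turing.Tape.mk' (Turing.ListBlank.mk l) (Turing.ListBlank.mk r)) b =
      Turing.Tape.mk' (Turing.ListBlank.mk ((simOp l.head?.join b false).apply l))
        (Turing.ListBlank.mk ((simOp l.head?.join b true).apply r)) := by
  rcases b with ⟨b, _ | _ | _⟩ <;>
    simp [MultiTapeTM.actOn, simOp, headI_eq_join]

/-- The increase by 2 occurs for `set₂` on an empty stack. The bound limits the cost of cleaning up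
after a run. -/
theorem simOp_length {Γ : Type} (a : Option Γ) (b : Option Γ × Option Turing.Dir) (s : Bool)
    (l : List (Option Γ)) : ((simOp a b s).apply l).length ≤ l.length + 2 := by
  rcases b with ⟨b, _ | _ | _⟩ <;> cases s <;> simp [simOp]
  all_goals omega

theorem update_simOp_apply (i : I) (S : (M i).Tapes → Bool → List (Option (M i).Symbol))
    (a : (M i).Tapes → Option (M i).Symbol × Option Turing.Dir)
    {inst : DecidableEq I} :
    (fun j k b => (Function.update noSub i
        (fun k => simOp (Function.update (Sub.empty : Sub M) i S i k false).head?.join (a k)) j k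
          b).apply (Function.update (Sub.empty : Sub M) i S j k b)) =
      Function.update Sub.empty i
        fun k b => (simOp (S k false).head?.join (a k) b).apply (S k b) := by
  funext j k b
  by_cases hj : j = i
  · subst hj
    simp
  · simp [Function.update_of_ne hj, noSub]

variable [Finite I] [∀ i, Finite (α i)] [Finite X] {N : ℕ}
  (code : X → {l : List (Option (Σ i, α i)) // l.length ≤ N})
  {inp : List X} {l r s : List (Option (Σ i, α i))} {sub : Sub M}

theorem reach_run {i : I} {L : Set (List (α i))} {t : ℕ → ℕ} (hM : (M i).DecidesInTime L t)
    (w : List (α i)) : ∃ acc : Bool, (acc = true ↔ w ∈ L) ∧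
      Reach code (3 * t w.length + w.length + 2)
        (cfg code (.run i (M i).start) inp l r s (Sub.ofInput w))
        (cfg code (if acc then .discard else .restore) inp l r s Sub.empty) := by
  classical
  obtain ⟨c, h1, h2, h3⟩ := hM w
  -- The index `k` counts simulated steps. The length bound makes cleaning cost at most `|w| + 2 * k
  -- + 1`, which with the `k` steps and the halting step gives `3 * k + |w| + 2`.
  let R : ℕ → (M i).Cfg → (machine M code).Cfg → Prop := fun k c d =>
    ∃ S : (M i).Tapes → Bool → List (Option (M i).Symbol),
      (∀ k, c.tape k = Turing.Tape.mk' (Turing.ListBlank.mk (S k false))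
        (Turing.ListBlank.mk (S k true))) ∧
      (∀ t b, (S t b).length ≤ w.length + 2 * k) ∧
      d = cfg code (.run i c.state) inp l r s (Function.update Sub.empty i S)
  have hhead : ∀ (c : (M i).Cfg) (S : (M i).Tapes → Bool → List (Option (M i).Symbol)),
      (∀ k, c.tape k = Turing.Tape.mk' (Turing.ListBlank.mk (S k false))
        (Turing.ListBlank.mk (S k true))) → (fun k => (c.tape k).head) =
      fun k => ((Function.update (Sub.empty : Sub M) i S i k true).head?).join := by
    intro c S hS
    funext k
    rw [hS k, Function.update_self]
    simp [headI_eq_join]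
  have hR : ∀ k a b a', R k a a' → (M i).step a = some b →
      ∃ b', ReachIn (machine M code).step 1 a' b' ∧ R (k + 1) b b' := by
    rintro k a b _ ⟨S, hS, hlen, rfl⟩ hstep
    obtain ⟨x, hx, rfl⟩ := Option.map_eq_some_iff.1 hstep
    rw [hhead a S hS] at hx
    refine ⟨_, .single (step_cfg (a := .keep) (b := .keep) (c := .keep) (d := .keep) (q' := .run i x.1)
      (e := (Function.update noSub i fun k =>
        simOp ((Function.update (Sub.empty : Sub M) i S i k false).head?).join (x.2 k))) ?_
        rfl rfl rfl rfl (update_simOp_apply i S x.2)),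
      _, fun k => ?_, fun t b => ?_, rfl⟩
    · change (match (M i).transition a.state
        (fun k => ((Function.update (Sub.empty : Sub M) i S i k true).head?).join) with
        | none => _
        | some a => _) = _
      rw [hx]
      rfl
    · simp only [hS k]
      exact actOn_mk' _ _ _
    · refine (simOp_length _ _ _ _).trans ?_
      have := hlen t b
      omega
  obtain ⟨k, hk, d, hd, S, hS, hlen, rfl⟩ := (ReachIn.of_evalsToInTime h1).simulate R hR
    (a' := cfg code (.run i (M i).start) inp l r s (Sub.ofInput w))
    ⟨fun k b => if k = (M i).inputTape ∧ b = true then w.map fun a => some ((M i).letter a) else [],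
      fun k => by
        simp only [MultiTapeTM.init]
        by_cases hk : k = (M i).inputTape <;> simp [hk, Turing.Tape.mk₁, Turing.Tape.mk₂],
      fun t b => by dsimp only; split_ifs <;> simp, rfl⟩
  have h2' := Option.map_eq_none_iff.1 h2
  rw [hhead c S hS] at h2'
  have h4 : (machine M code).step
      (cfg code (.run i c.state) inp l r s (Function.update Sub.empty i S)) =
      some (cfg code (.clean (decide (c.state ∈ (M i).accepting))) inp l r s
        (Function.update Sub.empty i S)) := by
    refine step_cfg_stay ?_
    change (match (M i).transition c.state
      (fun k => ((Function.update (Sub.empty : Sub M) i S i k true).head?).join) with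
      | none => _
      | some a => _) = _
    rw [h2']
  refine ⟨decide (c.state ∈ (M i).accepting), by simpa using h3, ?_⟩
  refine ((hd.tail h4).trans (reach_clean code _ (w.length + 2 * k) ?_)).mono (by omega)
  intro j k' b
  by_cases hj : j = i
  · subst hj
    simpa using hlen k' b
  · simp [Function.update_of_ne hj, Sub.empty]

end FreeProductMachine

namespace FreeProductMachine

variable {I : Type} {α : I → Type} {M : ∀ i, MultiTapeTM (α i)} {X : Type}

/-! ### Reduced words -/

/-- The string of letters of a word, which is given as a list of syllables. -/
def str (p : List (Σ i, List (α i))) : List (Option (Σ i, α i)) := p.flatMap fun q => letters q.1 q.2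

/-- The string of a list of words; each word is preceded by a separator. -/
def enc (ps : List (List (Σ i, List (α i)))) : List (Option (Σ i, α i)) :=
  ps.flatMap fun p => none :: str p

/-- A word is reduced with respect to the languages of the trivial words of the factors if adjacent
syllables are in distinct factors and no syllable is trivial. -/
def Reduced (L : ∀ i, Set (List (α i))) (p : List (Σ i, List (α i))) : Prop :=
  (p.map Sigma.fst).IsChain (· ≠ ·) ∧ ∀ q ∈ p, q.2 ∉ L q.1

/-- The product of the values of the letters of a word. -/
def wordProd {P : Type*} [Monoid P] (v : ∀ i, α i → P) (p : List (Σ i, List (α i))) : P :=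
  (p.map fun q => (q.2.map (v q.1)).prod).prod

@[simp] theorem str_nil : str ([] : List (Σ i, List (α i))) = [] := rfl

@[simp] theorem str_cons (q : Σ i, List (α i)) (p : List (Σ i, List (α i))) :
    str (q :: p) = letters q.1 q.2 ++ str p := List.flatMap_cons

@[simp] theorem str_append (p q : List (Σ i, List (α i))) : str (p ++ q) = str p ++ str q :=
  List.flatMap_append

@[simp] theorem enc_nil : enc ([] : List (List (Σ i, List (α i)))) = [] := rfl

@[simp] theorem enc_cons (p : List (Σ i, List (α i))) (ps : List (List (Σ i, List (α i)))) :
    enc (p :: ps) = none :: (str p ++ enc ps) := by simp [enc]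

@[simp] theorem letters_length (i : I) (u : List (α i)) : (letters i u).length = u.length := by
  simp [letters]

theorem letters_append (i : I) (u v : List (α i)) :
    letters i (u ++ v) = letters i u ++ letters i v := by
  simp [letters]

theorem exists_str_eq (p : List (Σ i, List (α i))) :
    ∃ u : List (Σ i, α i), str p = u.map some := by
  induction p with
  | nil => exact ⟨[], rfl⟩
  | cons q p ih =>
    obtain ⟨u, hu⟩ := ih
    exact ⟨q.2.map (Sigma.mk q.1) ++ u, by simp [hu, letters]⟩

/-- The top of the stack is not a letter. -/
def NoLetter (l : List (Option (Σ i, α i))) : Prop := ∀ a, l.head? ≠ some (some a)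

theorem noLetter_enc (ps : List (List (Σ i, List (α i)))) : NoLetter (enc ps) := by
  cases ps <;> simp [NoLetter]

theorem noLetter_none (l : List (Option (Σ i, α i))) : NoLetter (none :: l) := by
  simp [NoLetter]

variable {L : ∀ i, Set (List (α i))} {l r : List (Option (Σ i, α i))}

/-- Since the empty word is trivial, a reduced word has no empty syllable; the letter after a
syllable therefore belongs to an adjacent syllable, in another factor. -/
theorem topNe_str_append (hL : ∀ i, [] ∈ L i) {i : I} {u : List (α i)}
    {p : List (Σ i, List (α i))} (hp : Reduced L (⟨i, u⟩ :: p)) (hr : NoLetter r) :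
    TopNe i (str p ++ r) := by
  rcases p with - | ⟨⟨j, - | ⟨a, w⟩⟩, p⟩
  · exact fun a ha => (hr a ha).elim
  · exact (hp.2 ⟨j, []⟩ (by simp) (hL j)).elim
  · have := hp.1
    simp only [List.map_cons, List.isChain_cons_cons] at this
    intro b hb
    simp only [str_cons, letters, List.map_cons, List.cons_append, List.head?_cons,
      Option.some.injEq] at hb
    subst hb
    exact this.1.symm

theorem topNe_str_reverse_append (hL : ∀ i, [] ∈ L i) {i : I} {u : List (α i)}
    {p : List (Σ i, List (α i))} (hp : Reduced L (p ++ [⟨i, u⟩])) (hl : NoLetter l) :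
    TopNe i ((str p).reverse ++ l) := by
  rcases List.eq_nil_or_concat p with rfl | ⟨p, ⟨j, w⟩, rfl⟩
  · exact fun a ha => (hl a ha).elim
  rcases List.eq_nil_or_concat w with rfl | ⟨w, a, rfl⟩
  · exact (hp.2 ⟨j, []⟩ (by simp) (hL j)).elim
  · have := hp.1
    simp only [List.concat_eq_append, List.map_append, List.append_assoc] at this
    have := this.right_of_append
    simp only [List.map_cons, List.map_nil, List.cons_append, List.nil_append,
      List.isChain_cons_cons] at this
    intro b hb
    simp [letters] at hb
    subst hb
    exact this.1

/-- The fused syllable stays in the factor of the two it replaces, so the adjacency conditions on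
either side carry over. -/
theorem Reduced.append_cons {p q : List (Σ i, List (α i))} {i : I} {u u' v : List (α i)}
    (hp : Reduced L (p ++ [⟨i, u⟩])) (hq : Reduced L (⟨i, u'⟩ :: q)) (hv : v ∉ L i) :
    Reduced L (p ++ [⟨i, v⟩] ++ q) := by
  refine ⟨?_, ?_⟩
  · have h1 := hp.1
    have h2 := hq.1
    simp only [List.map_append, List.map_cons, List.map_nil, List.append_assoc,
      List.cons_append, List.nil_append] at h1 h2 ⊢
    exact List.isChain_split.2 ⟨h1, h2⟩
  · intro x hx
    simp only [List.append_assoc, List.cons_append, List.nil_append, List.mem_append,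
      List.mem_cons] at hx
    rcases hx with hx | rfl | hx
    · exact hp.2 x (by simp [hx])
    · exact hv
    · exact hq.2 x (by simp [hx])

theorem Reduced.append_of_ne {p q : List (Σ i, List (α i))} {x y : Σ i, List (α i)}
    (hp : Reduced L (p ++ [x])) (hq : Reduced L (y :: q)) (hxy : x.1 ≠ y.1) :
    Reduced L (p ++ [x] ++ y :: q) := by
  refine ⟨?_, ?_⟩
  · have h1 := hp.1
    have h2 := hq.1
    simp only [List.map_append, List.map_cons, List.map_nil, List.append_assoc,
      List.cons_append, List.nil_append] at h1 h2 ⊢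
    exact List.isChain_split.2 ⟨h1, List.isChain_cons_cons.2 ⟨hxy, h2⟩⟩
  · intro z hz
    rcases List.mem_append.1 hz with hz | hz
    exacts [hp.2 z hz, hq.2 z hz]

theorem Reduced.left {p q : List (Σ i, List (α i))} (h : Reduced L (p ++ q)) : Reduced L p :=
  ⟨(List.map_append ▸ h.1 : (_ ++ _ : List I).IsChain _).left_of_append,
    fun x hx => h.2 x (List.mem_append_left _ hx)⟩

theorem Reduced.right {p q : List (Σ i, List (α i))} (h : Reduced L (p ++ q)) : Reduced L q :=
  ⟨(List.map_append ▸ h.1 : (_ ++ _ : List I).IsChain _).right_of_append,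
    fun x hx => h.2 x (List.mem_append_right _ hx)⟩

theorem wordProd_append {P : Type*} [Monoid P] (v : ∀ i, α i → P) (p q : List (Σ i, List (α i))) :
    wordProd v (p ++ q) = wordProd v p * wordProd v q := by
  simp [wordProd]

/-! ### The cancellation loop -/

variable [Finite I] [∀ i, Finite (α i)] [Finite X] {N : ℕ}
  (code : X → {l : List (Option (Σ i, α i)) // l.length ≤ N}) {inp : List X}

/-- Besides the run, every letter of the two syllables is moved a bounded number of times: gathered,
handed to the machine with a saved copy, and finally discarded or restored. -/
theorem reach_test {t : I → ℕ → ℕ} (hM : ∀ i, (M i).DecidesInTime (L i) (t i)) {i : I}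
    {u v : List (α i)} (hu : u ≠ []) (hv : v ≠ []) (hl : TopNe i l) (hr : TopNe i r) :
    ∃ acc : Bool, (acc = true ↔ u ++ v ∈ L i) ∧
      Reach code (3 * t i (u.length + v.length) + 4 * (u.length + v.length) + 6)
        (cfg code .cancel inp ((letters i u).reverse ++ l) (letters i v ++ r) [] (Sub.empty (M := M)))
        (if acc then cfg code .cancel inp l r [] Sub.empty
          else cfg code (.shift true true) inp ((letters i (u ++ v)).reverse ++ l) r [] Sub.empty) := by
  obtain ⟨acc, hacc, h⟩ := reach_run (inp := inp) (l := l) (r := r)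
    (s := letters i (u ++ v)) code (hM i) (u ++ v)
  refine ⟨acc, hacc, ?_⟩
  have h0 : (machine M code).step
      (cfg code .cancel inp ((letters i u).reverse ++ l) (letters i v ++ r) [] Sub.empty) =
      some (cfg code (.gatherRight i) inp ((letters i u).reverse ++ l) (letters i v ++ r) []
        Sub.empty) := by
    obtain ⟨u, a, rfl⟩ := (List.eq_nil_or_concat u).resolve_left hu
    obtain ⟨b, v, rfl⟩ := List.exists_cons_of_ne_nil hv
    rw [List.concat_eq_append, letters_append, List.reverse_append]
    exact step_cfg_stay (if_pos rfl)
  have h1 := reach_gatherRight (inp := inp) (l := (letters i u).reverse ++ l) (s := [])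
    (sub := Sub.empty (M := M)) code v hr
  have h2 := reach_gatherLeft (inp := inp) (r := r) (s := []) (M := M) code (u ++ v) [] hl
  rw [← List.append_assoc, ← List.reverse_append, ← letters_append] at h1
  simp only [List.append_nil, Sub.ofInput_nil] at h2
  have h3 := ReachIn.head h0 ((h1.trans h2).trans h)
  rw [List.length_append] at h3
  cases acc
  · refine (h3.trans (reach_restore code)).mono ?_
    simp
    omega
  · refine (h3.trans (reach_discard code)).mono ?_
    simp
    omega

/-- The amortization: a successful test deletes the letters tested, and an unsuccessful one ends the
loop, so the tests concern disjoint sets of letters and superadditivity of `W` sums their costs. The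
seam between `p'` and `q'` only records where the head stands; it may split the product at any
syllable boundary. -/
theorem reach_cancel {t : I → ℕ → ℕ} (hM : ∀ i, (M i).DecidesInTime (L i) (t i))
    {P : Type*} [Monoid P] {v : ∀ i, α i → P} (hL : ∀ i u, u ∈ L i ↔ (u.map (v i)).prod = 1)
    {W : ℕ → ℕ} (hW : ∀ a b, W a + W b ≤ W (a + b))
    (hWt : ∀ i a, 0 < a → 3 * t i a + 10 * a ≤ W a)
    (hl : NoLetter l) (hr : NoLetter r) (p q : List (Σ i, List (α i))) (hp : Reduced L p)
    (hq : Reduced L q) :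
    ∃ p' q', Reduced L (p' ++ q') ∧ wordProd v (p' ++ q') = wordProd v p * wordProd v q ∧
      (str (p' ++ q')).length ≤ (str p).length + (str q).length ∧
      Reach code (W ((str p).length + (str q).length) + 2)
        (cfg code .cancel inp ((str p).reverse ++ l) (str q ++ r) [] (Sub.empty (M := M)))
        (cfg code (.shift true true) inp ((str p').reverse ++ l) (str q' ++ r) [] Sub.empty) := by
  have hL0 : ∀ i, [] ∈ L i := fun i => (hL i []).2 (by simp)
  induction p using List.reverseRecOn generalizing q with
  | nil =>
    refine ⟨[], q, hq, by simp [wordProd], by simp, ReachIn.mono (n := 1) (.single ?_) (by omega)⟩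
    refine step_cfg_stay ?_
    simp only [str_nil, List.reverse_nil, List.nil_append]
    rcases l with - | ⟨- | a, l⟩
    exacts [rfl, rfl, (hl a rfl).elim]
  | append_singleton p x ih =>
    obtain ⟨i, u⟩ := x
    have hu : u ≠ [] := by
      rintro rfl
      exact hp.2 ⟨i, []⟩ (by simp) (hL0 i)
    rcases q with - | ⟨⟨j, w⟩, q⟩
    · refine ⟨_, [], by simpa using hp, by simp [wordProd], by simp,
        ReachIn.mono (n := 1) (.single ?_) (by omega)⟩
      refine step_cfg_stay ?_
      simp only [str_nil, List.nil_append]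
      obtain ⟨u, a, rfl⟩ := (List.eq_nil_or_concat u).resolve_left hu
      simp only [str_append, str_cons, letters, List.concat_eq_append, List.map_append,
        List.map_cons, List.reverse_append, List.append_assoc, str_nil, List.map_nil,
        List.reverse_cons, List.reverse_nil, List.nil_append, List.cons_append]
      rcases r with - | ⟨- | a, r⟩
      exacts [rfl, rfl, (hr a rfl).elim]
    have hw : w ≠ [] := by
      rintro rfl
      exact hq.2 ⟨j, []⟩ (by simp) (hL0 j)
    by_cases hij : i = j
    · subst hij
      obtain ⟨acc, hacc, h⟩ := reach_test (inp := inp) code hM hu hw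
        (topNe_str_reverse_append hL0 hp hl) (topNe_str_append hL0 hq hr)
      have hlen : (str (p ++ [⟨i, u⟩])).length + (str (⟨i, w⟩ :: q)).length =
          (u.length + w.length) + ((str p).length + (str q).length) := by
        simp
        omega
      have hpos : 0 < u.length + w.length := by
        have := List.length_pos_iff.2 hu
        omega
      have h1 := hWt i _ hpos
      -- The budget splits into a share for the two syllables tested, which also covers the constant
      -- 6 because they are nonempty, and a share for the remaining letters.
      have h2 := hW (u.length + w.length) ((str p).length + (str q).length)
      cases acc
      · have hn : u ++ w ∉ L i := by simpa using hacc
        refine ⟨p ++ [⟨i, u ++ w⟩], q, hp.append_cons hq hn, ?_, ?_, ?_⟩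
        · simp [wordProd, mul_assoc]
        · simp
          omega
        · rw [hlen]
          refine ReachIn.mono (n := 3 * t i (u.length + w.length) +
            4 * (u.length + w.length) + 6) (by simpa using h) ?_
          have := List.length_pos_iff.2 hw
          have := List.length_pos_iff.2 hu
          omega
      · have hn : u ++ w ∈ L i := by simpa using hacc
        obtain ⟨p', q', h3, h4, h5, h6⟩ := ih q hp.left (Reduced.right (p := [_]) hq)
        refine ⟨p', q', h3, h4.trans ?_, ?_, ?_⟩
        · have := (hL i _).1 hn
          rw [List.map_append, List.prod_append] at this
          simp only [wordProd, List.map_append, List.prod_append, List.map_cons, List.map_nil,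
            List.prod_cons, List.prod_nil, mul_one, mul_assoc]
          rw [← mul_assoc ((u.map (v i)).prod), this, one_mul]
        · omega
        · rw [hlen]
          refine (ReachIn.trans (by simpa using h) h6).mono ?_
          have := List.length_pos_iff.2 hw
          have := List.length_pos_iff.2 hu
          omega
    · refine ⟨_, _, hp.append_of_ne hq hij, wordProd_append _ _ _, by rw [str_append, List.length_append],
        ReachIn.mono (n := 1) (.single ?_) (by omega)⟩
      refine step_cfg_stay ?_
      obtain ⟨u, a, rfl⟩ := (List.eq_nil_or_concat u).resolve_left hu
      obtain ⟨b, w, rfl⟩ := List.exists_cons_of_ne_nil hw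
      simp only [str_append, str_cons, letters, List.concat_eq_append, List.map_append,
        List.map_cons, List.reverse_append, List.append_assoc, str_nil, List.map_nil,
        List.reverse_cons, List.reverse_nil, List.nil_append, List.cons_append]
      exact if_neg hij

end FreeProductMachine

/-! ### Passes over the list of words, and their iteration -/

namespace FreeProductMachine

variable {I : Type} {α : I → Type} {M : ∀ i, MultiTapeTM (α i)} {X : Type}
  [Finite I] [∀ i, Finite (α i)] [Finite X] {N : ℕ}
  {code : X → {l : List (Option (Σ i, α i)) // l.length ≤ N}} {inp : List X}
  {L : ∀ i, Set (List (α i))} {t : I → ℕ → ℕ} {P : Type*} [Monoid P] {v : ∀ i, α i → P}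
  {W : ℕ → ℕ}

theorem reach_shift_str (b c : Bool) (p : List (Σ i, List (α i)))
    {l r s : List (Option (Σ i, α i))} {sub : Sub M} :
    Reach code (str p).length (cfg code (.shift b c) inp l (str p ++ r) s sub)
      (cfg code (.shift b c) inp ((str p).reverse ++ l) r s sub) := by
  obtain ⟨u, hu⟩ := exists_str_eq p
  rw [hu, List.length_map]
  exact reach_shift_letters code b c u

/-- One copy of `W` pays for the cancellations; the other pays for moving across the string and,
through the separators, for the constants. -/
theorem reach_pass (hM : ∀ i, (M i).DecidesInTime (L i) (t i))
    (hL : ∀ i u, u ∈ L i ↔ (u.map (v i)).prod = 1) (hW : ∀ a b, W a + W b ≤ W (a + b))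
    (hWt : ∀ i a, 0 < a → 3 * t i a + 10 * a ≤ W a) (hWa : ∀ a, 10 * a ≤ W a) (c : Bool) :
    ∀ (ps : List (List (Σ i, List (α i)))) (l : List (Option (Σ i, α i))),
      (∀ p ∈ ps, Reduced L p) → ∃ (ps' : List (List (Σ i, List (α i)))) (b : Bool),
        (∀ p ∈ ps', Reduced L p) ∧ (ps'.map (wordProd v)).prod = (ps.map (wordProd v)).prod ∧
        ps'.length = (ps.length + 1) / 2 ∧ (enc ps').length ≤ (enc ps).length ∧
        Reach code (2 * W (enc ps).length)
          (cfg code (.shift true c) inp l (enc ps) [] (Sub.empty (M := M)))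
          (cfg code (.shift b (c || decide (2 ≤ ps.length))) inp ((enc ps').reverse ++ l) [] []
            Sub.empty)
  | [], l, _ => ⟨[], true, by simp, rfl, by simp, le_rfl, by simpa using ReachIn.refl.mono (Nat.zero_le _)⟩
  -- A last word without a partner is copied unchanged.
  | [p], l, h => by
    refine ⟨[p], false, h, rfl, by simp, le_rfl, ?_⟩
    have h1 : (machine M code).step (cfg code (.shift true c) inp l (none :: (str p ++ [])) []
        (Sub.empty (M := M))) = some (cfg code (.shift false c) inp (none :: l) (str p ++ []) []
          Sub.empty) := step_cfg rfl rfl rfl rfl rfl rfl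
    have h2 := (ReachIn.head h1 (reach_shift_str false c p)).mono
      (m := 2 * W (enc [p]).length) (by
        have := hWa (enc [p]).length
        simp at this ⊢
        omega)
    simpa using h2
  | p :: q :: ps, l, h => by
    have hp := h p (by simp)
    have hq := h q (by simp)
    obtain ⟨p', q', h1, h2, h3, h4⟩ := reach_cancel (inp := inp) code hM hL hW hWt
      (noLetter_none l) (noLetter_enc ps) p q hp hq
    obtain ⟨ps', b, h5, h6, h7, h8, h9⟩ := reach_pass hM hL hW hWt hWa true ps
      ((enc [p' ++ q']).reverse ++ l) (fun x hx => h x (by simp [hx]))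
    refine ⟨(p' ++ q') :: ps', b, ?_, ?_, ?_, ?_, ?_⟩
    · intro x hx
      rcases List.mem_cons.1 hx with rfl | hx
      exacts [h1, h5 x hx]
    · simp [h2, h6, mul_assoc]
    · simp only [List.length_cons, h7]
      omega
    · simp at h3 h8 ⊢
      omega
    · have e1 : (machine M code).step (cfg code (.shift true c) inp l
          (none :: (str p ++ none :: (str q ++ enc ps))) [] (Sub.empty (M := M))) =
          some (cfg code (.shift false c) inp (none :: l)
            (str p ++ none :: (str q ++ enc ps)) [] Sub.empty) :=
        step_cfg rfl rfl rfl rfl rfl rfl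
      have e2 : (machine M code).step (cfg code (.shift false c) inp ((str p).reverse ++ none :: l)
          (none :: (str q ++ enc ps)) [] (Sub.empty (M := M))) =
          some (cfg code .cancel inp ((str p).reverse ++ none :: l)
            (str q ++ enc ps) [] Sub.empty) :=
        step_cfg rfl rfl rfl rfl rfl rfl
      have e3 := ReachIn.head e1 ((reach_shift_str false c p).trans (ReachIn.head e2 (h4.trans
        (reach_shift_str true true q'))))
      -- The separator before `q` is gone, so the two strings now read as a single word.
      have e4 : (str q').reverse ++ ((str p').reverse ++ none :: l) =
          (enc [p' ++ q']).reverse ++ l := by simp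
      rw [e4] at e3
      have e5 := e3.trans h9
      have e6 : (enc (p :: q :: ps)).length =
          ((str p).length + (str q).length + 2) + (enc ps).length := by
        simp
        omega
      have w1 := hW ((str p).length + (str q).length + 2) (enc ps).length
      have w2 := hW ((str p).length + (str q).length) 2
      have w3 := hWa ((str p).length + (str q).length + 2)
      have w4 := hWa 2
      have e7 : (str q').length ≤ (str p).length + (str q).length := by
        simp at h3
        omega
      rw [e6]
      have e8 := e5.mono (m := 2 * W ((str p).length + (str q).length + 2 + (enc ps).length))
        (by omega)
      simpa using e8

/-- A round takes `k` words to `⌈k / 2⌉`, which is the recursion of `Nat.clog 2`. It costs `2 * W n`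
for the pass and at most `n + 2` for the rewinding and the change of state. -/
theorem reach_rounds (hM : ∀ i, (M i).DecidesInTime (L i) (t i))
    (hL : ∀ i u, u ∈ L i ↔ (u.map (v i)).prod = 1) (hW : ∀ a b, W a + W b ≤ W (a + b))
    (hWt : ∀ i a, 0 < a → 3 * t i a + 10 * a ≤ W a) (hWa : ∀ a, 10 * a ≤ W a)
    (hfree : ∀ p, Reduced L p → wordProd v p = 1 → p = []) (n k : ℕ)
    (ps : List (List (Σ i, List (α i)))) (hk : ps.length = k) (hn : (enc ps).length ≤ n)
    (hps : ∀ p ∈ ps, Reduced L p) :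
    ∃ (acc : Bool) (l : List (Option (Σ i, α i))),
      (acc = true ↔ (ps.map (wordProd v)).prod = 1) ∧
      Reach code ((Nat.clog 2 k + 1) * (3 * W n + 2))
        (cfg code .rewind inp (enc ps).reverse [] [] (Sub.empty (M := M)))
        (cfg code (.done acc) inp l [] [] Sub.empty) := by
  induction k using Nat.strong_induction_on generalizing ps with
  | _ k ih =>
    obtain ⟨ps', b, h1, h2, h3, h4, h5⟩ := reach_pass (inp := inp) (code := code) hM hL hW hWt hWa
      false ps [] hps
    have hmono : W (enc ps).length ≤ W n := by
      have := hW (enc ps).length (n - (enc ps).length)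
      rw [Nat.add_sub_cancel' hn] at this
      omega
    have hWn := hWa n
    have h6 := (reach_rewind (inp := inp) (l := (enc ps).reverse) (r := []) (s := [])
      (sub := Sub.empty (M := M)) code)
    simp only [List.reverse_reverse, List.append_nil, List.length_reverse] at h6 h5
    have h7 := h6.trans h5
    by_cases hk2 : 2 ≤ k
    · have e : (machine M code).step (cfg code (.shift b true) inp (enc ps').reverse [] []
          (Sub.empty (M := M))) =
          some (cfg code .rewind inp (enc ps').reverse [] [] Sub.empty) := step_cfg_stay rfl
      obtain ⟨acc, l, h8, h9⟩ := ih ((k + 1) / 2) (by omega) ps' (by rw [h3, hk]) (h4.trans hn) h1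
      refine ⟨acc, l, h8.trans (by rw [h2]), ?_⟩
      rw [hk, decide_eq_true hk2] at h7
      refine ((h7.tail e).trans h9).mono ?_
      rw [Nat.clog_of_two_le Nat.one_lt_two hk2, show k + 2 - 1 = k + 1 by omega,
        Nat.succ_mul (Nat.clog 2 ((k + 1) / 2) + 1)]
      omega
    · rw [hk, decide_eq_false hk2] at h7
      -- At most one word is left. An empty list or an empty word leaves no letter on top; a
      -- nonempty reduced word leaves its last letter there and is nontrivial by `hfree`.
      have e : ∃ acc : Bool, (acc = true ↔ (ps.map (wordProd v)).prod = 1) ∧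
          (machine M code).step (cfg code (.shift b false) inp (enc ps').reverse [] []
            (Sub.empty (M := M))) =
            some (cfg code (.done acc) inp (enc ps').reverse [] [] Sub.empty) := by
        rw [← h2]
        rcases ps' with - | ⟨p, - | ⟨q, ps'⟩⟩
        · exact ⟨true, by simp, step_cfg_stay rfl⟩
        · rcases List.eq_nil_or_concat p with rfl | ⟨p, ⟨i, u⟩, rfl⟩
          · exact ⟨true, by simp [wordProd], step_cfg_stay rfl⟩
          · have hr := h1 _ (List.mem_singleton_self _)
            rcases List.eq_nil_or_concat u with rfl | ⟨u, a, rfl⟩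
            · exact (hr.2 ⟨i, []⟩ (by simp) ((hL i []).2 (by simp))).elim
            · refine ⟨false, ?_, ?_⟩
              · simp only [Bool.false_eq_true, false_iff, List.map_cons, List.map_nil,
                  List.prod_cons, List.prod_nil, mul_one]
                intro h
                simpa using hfree _ hr h
              · refine step_cfg_stay ?_
                simp only [enc_cons, List.concat_eq_append, letters, str_append, str_cons,
                  List.map_append, List.map_cons, List.reverse_append, List.append_assoc, str_nil,
                  List.map_nil, List.reverse_cons, List.reverse_nil, List.nil_append,
                  List.cons_append, enc_nil, List.append_nil]
                rfl
        · simp at h3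
          omega
      obtain ⟨acc, hacc, e⟩ := e
      refine ⟨acc, _, hacc, (h7.tail e).mono ?_⟩
      rw [Nat.add_mul]
      omega

/-- The free product machine decides the word problem. -/
theorem machine_decidesInTime (hM : ∀ i, (M i).DecidesInTime (L i) (t i))
    (hL : ∀ i u, u ∈ L i ↔ (u.map (v i)).prod = 1) (hW : ∀ a b, W a + W b ≤ W (a + b))
    (hWt : ∀ i a, 0 < a → 3 * t i a + 10 * a ≤ W a) (hWa : ∀ a, 10 * a ≤ W a)
    (hfree : ∀ p, Reduced L p → wordProd v p = 1 → p = [])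
    (g : X → List (Σ i, List (α i))) (hg : ∀ x, Reduced L (g x))
    (hcode : ∀ x, (code x).1 = enc [g x]) :
    (machine M code).DecidesInTime {w | (w.map fun x => wordProd v (g x)).prod = 1} fun n =>
      (Nat.clog 2 n + 1) * (3 * W (N * n) + 2) + n * (N + 1) + 1 := by
  intro w
  have e : (w.flatMap fun x => (code x).1) = enc (w.map g) := by
    simp [hcode, enc, List.flatMap_map]
  have hlen : (enc (w.map g)).length ≤ N * w.length := by
    rw [← e]
    clear e
    induction w with
    | nil => simp
    | cons x w ih =>
      have := (code x).2
      simp only [List.flatMap_cons, List.length_append, List.length_cons, Nat.mul_succ]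
      omega
  have h1 := reach_load (l := []) (r := []) (s := []) (sub := Sub.empty (M := M)) code w
  rw [e, List.append_nil] at h1
  obtain ⟨acc, l, h2, h3⟩ := reach_rounds (inp := []) (code := code) hM hL hW hWt hWa hfree _
    w.length (w.map g) (by simp) hlen (by simp [hg])
  refine ⟨cfg code (.done acc) [] l [] [] Sub.empty, ?_, ?_, ?_⟩
  · have e : (machine M code).init w =
        cfg code (.load ⟨[], Nat.zero_le _⟩) w [] [] [] Sub.empty := by
      classical
      change (_, _) = (_, _)
      congr 1
      funext k
      by_cases hk : k = FPStack.input
      · subst hk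
        exact (Function.update_self (f := fun k => ([] : List (Sym M X k))) FPStack.input _).trans
          (List.map_id _)
      · refine (Function.update_of_ne (f := fun k => ([] : List (Sym M X k))) hk _).trans ?_
        cases k
        · exact (hk rfl).elim
        all_goals rfl
    rw [e]
    refine (h1.trans h3).mono ?_
    dsimp only
    omega
  · rfl
  · change FPState.done acc ∈ ({.done true} : Set _) ↔ _
    simp [h2, Function.comp_def]

end FreeProductMachine

/-! ## Growth functions -/

namespace NatConvex

variable {f : ℕ → ℝ}

theorem monotone_diff (hf : NatConvex f) : Monotone fun n => f (n + 1) - f n :=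
  monotone_nat_of_le_succ fun n => by
    have := hf n
    linarith [show f (n + 1 + 1) = f (n + 2) from rfl]

/-- Increments of a convex function grow; equivalently, `n ↦ f (c + n) - f c` is superadditive. -/
theorem add_le (hf : NatConvex f) (c a b : ℕ) : f (c + a) + f (c + b) ≤ f (c + (a + b)) + f c := by
  induction b with
  | zero => simp
  | succ b ih =>
    have := hf.monotone_diff (show c + b ≤ c + (a + b) by omega)
    simp only [← add_assoc] at this ih ⊢
    linarith

/-- A convex `f` with `n ≤ f n` may decrease at first; this is the substitute for monotonicity. -/
theorem le_add_of_le (hf : NatConvex f) (h0 : ∀ n : ℕ, (n : ℝ) ≤ f n) {x y : ℕ} (h : x ≤ y) :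
    f x ≤ f y + f 0 := by
  have h1 := hf.add_le 0 x (y - x)
  simp only [zero_add, Nat.add_sub_cancel' h] at h1
  have h2 := (Nat.cast_nonneg (α := ℝ) _).trans (h0 (y - x))
  linarith

/-- A superadditive bound for running times of growth at most that of a convex function. -/
theorem exists_superadditive (hf : NatConvex f) (h0 : ∀ n : ℕ, (n : ℝ) ≤ f n) {I : Type*} [Finite I]
    (t : I → ℕ → ℕ) (ht : ∀ i, GrowthLE (fun n => (t i n : ℝ)) f) :
    ∃ (W : ℕ → ℕ) (C : ℕ) (D : ℝ), 0 ≤ D ∧ (∀ a b, W a + W b ≤ W (a + b)) ∧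
      (∀ i a, 0 < a → 3 * t i a + 10 * a ≤ W a) ∧ (∀ a, 10 * a ≤ W a) ∧
      ∀ n, (W n : ℝ) ≤ 3 * C * f (C * n + C) + D * n := by
  choose c _ hc using ht
  obtain ⟨C, hC⟩ := (Set.finite_range c).bddAbove
  have hC : ∀ i, c i ≤ C := fun i => hC ⟨i, rfl⟩
  have hnn : ∀ n, 0 ≤ f n := fun n => (Nat.cast_nonneg n).trans (h0 n)
  have hCf := mul_nonneg (Nat.cast_nonneg (α := ℝ) C) (hnn C)
  have hCf0 := mul_nonneg (Nat.cast_nonneg (α := ℝ) C) (hnn 0)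
  have hC0 := Nat.cast_nonneg (α := ℝ) C
  -- For `a ≥ 1` the term `D * a` absorbs the subtracted `3 * C * f C`, the defect `3 * C * f 0` of
  -- monotonicity, and the linear terms of `GrowthLE` and of the overhead `10 * a`.
  obtain ⟨D, hD⟩ : ∃ D : ℝ, D = 3 * (C * f C) + 3 * (C * f 0) + 6 * C + 10 := ⟨_, rfl⟩
  obtain ⟨F, hF⟩ : ∃ F : ℕ → ℝ, ∀ n, F n = 3 * C * (f (C + C * n) - f C) + D * n :=
    ⟨_, fun _ => rfl⟩
  -- Length `0` is excluded: superadditivity forces the bound to vanish there, while a machine may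
  -- need time on the empty word.
  have hpos : ∀ a, 0 < a → 3 * (C * f (C + C * a)) + 3 * (C * f 0) + 3 * C * a + 3 * C + 10 * a ≤
      F a := by
    intro a ha
    have ha' : (1 : ℝ) ≤ a := by exact_mod_cast ha
    have e : D * a = (3 * (C * f C) + 3 * (C * f 0) + 3 * C) * (a - 1) +
      (3 * (C * f C) + 3 * (C * f 0) + 3 * C) + (3 * C * a + 10 * a) := by
      rw [hD]
      ring
    have := mul_nonneg (show 0 ≤ 3 * (C * f C) + 3 * (C * f 0) + 3 * C by positivity)
      (sub_nonneg.2 ha')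
    rw [hF, e]
    linarith
  have h10 : ∀ a : ℕ, 10 * (a : ℝ) ≤ F a := by
    intro a
    rcases a.eq_zero_or_pos with rfl | ha
    · simp [hF]
    · have := hpos a ha
      have := mul_nonneg hC0 (hnn (C + C * a))
      have : 0 ≤ 3 * (C : ℝ) * a := by positivity
      linarith
  have hF0 : ∀ a, 0 ≤ F a := fun a => (by positivity : (0 : ℝ) ≤ 10 * a).trans (h10 a)
  have hD0 : 0 ≤ D := by linarith
  refine ⟨fun n => ⌊F n⌋₊, C, D, hD0, fun a b => Nat.le_floor ?_, fun i a ha => Nat.le_floor ?_,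
    fun a => Nat.le_floor ?_, fun n => (Nat.floor_le (hF0 n)).trans ?_⟩
  · push_cast
    refine (add_le_add (Nat.floor_le (hF0 a)) (Nat.floor_le (hF0 b))).trans ?_
    have := mul_le_mul_of_nonneg_left (hf.add_le C (C * a) (C * b)) hC0
    simp only [hF, Nat.cast_add, Nat.mul_add]
    linarith
  · push_cast
    refine le_trans ?_ (hpos a ha)
    have hci : (c i : ℝ) ≤ C := by exact_mod_cast hC i
    have h1 : (t i a : ℝ) ≤ c i * f (c i * a + c i) + c i * a + c i := hc i a
    have h2 : f (c i * a + c i) ≤ f (C + C * a) + f 0 := hf.le_add_of_le h0 (by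
      rw [add_comm]
      exact Nat.add_le_add (hC i) (Nat.mul_le_mul_right a (hC i)))
    have h3 := mul_le_mul hci h2 (hnn _) hC0
    have h4 := mul_le_mul_of_nonneg_right hci (Nat.cast_nonneg (α := ℝ) a)
    linarith
  · push_cast
    exact h10 a
  · rw [hF, add_comm C]
    linarith

end NatConvex

/-- For `n > 1` one has `2 ^ (clog 2 n - 1) < n`, and `2 * log 2 > 1`. -/
theorem clog_two_le (n : ℕ) : (Nat.clog 2 n : ℝ) ≤ 2 * Real.log n + 1 := by
  rcases Nat.lt_or_ge 1 n with hn | hn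
  · have h1 := Nat.pow_pred_clog_lt_self (b := 2) Nat.one_lt_two hn
    have h2 : ((2 : ℝ) ^ (Nat.clog 2 n).pred) ≤ n := by exact_mod_cast h1.le
    have h3 := Real.log_le_log (by positivity) h2
    rw [Real.log_pow] at h3
    have h4 : (Nat.clog 2 n : ℝ) ≤ (Nat.clog 2 n).pred + 1 := by
      exact_mod_cast (show _ ≤ (Nat.clog 2 n).pred + 1 by rw [Nat.pred_eq_sub_one]; omega)
    have h5 := Real.log_two_gt_d9
    have h6 := Nat.cast_nonneg (α := ℝ) (Nat.clog 2 n).pred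
    nlinarith
  · interval_cases n <;> simp

theorem growthLE_log_mul {f : ℕ → ℝ} (hf : NatConvex f) (h0 : ∀ n : ℕ, (n : ℝ) ≤ f n)
    {W : ℕ → ℕ} {C : ℕ} {D : ℝ} (hD : 0 ≤ D)
    (hW : ∀ n, (W n : ℝ) ≤ 3 * C * f (C * n + C) + D * n) (N : ℕ) :
    GrowthLE (fun n => ((2 * ((Nat.clog 2 n + 1) * (3 * W (N * n) + 2) + n * (N + 1) + 1) : ℕ) : ℝ))
      fun n => Real.log n * f n := by
  have hnn : ∀ n, 0 ≤ f n := fun n => (Nat.cast_nonneg n).trans (h0 n)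
  -- The summands bound, in this order, the parts of `3 * W (N * n) + 2` due to `f x`, to `f 0`, to
  -- the linear term and to the constant 2, each as a multiple of `f x`.
  obtain ⟨Q, hQ⟩ : ∃ Q : ℝ, Q = 9 * C + 9 * (C * f 0) + 3 * D * N + 2 := ⟨_, rfl⟩
  have hQ0 : 0 ≤ Q := by
    have := hnn 0
    rw [hQ]
    positivity
  -- `8 * Q` is 2 for the stack simulation times 4 from `hclog` times `Q`; `C * N` and `C` make the
  -- argument of `f` at most `x`; `2 * (N + 1)` covers loading the input; and 4 gives `log x ≥ 1`
  -- even for `n = 0`.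
  obtain ⟨K, hK⟩ : ∃ K : ℕ, K = ⌈8 * Q⌉₊ + C * N + C + N + 2 * (N + 1) + 4 := ⟨_, rfl⟩
  have hKQ : 8 * Q ≤ K := by
    refine (Nat.le_ceil _).trans ?_
    exact_mod_cast (show _ ≤ K by omega)
  refine ⟨K, by omega, fun n => ?_⟩
  obtain ⟨x, hx⟩ : ∃ x : ℕ, x = K * n + K := ⟨_, rfl⟩
  have hx4 : (4 : ℝ) ≤ x := by
    exact_mod_cast (show 4 ≤ x by omega)
  have hlog : 1 ≤ Real.log x := by
    have h1 := Real.log_le_log (by norm_num) hx4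
    have h2 : Real.log 4 = 2 * Real.log 2 := by
      rw [show (4 : ℝ) = 2 ^ 2 by norm_num, Real.log_pow]
      norm_num
    have := Real.log_two_gt_d9
    linarith
  have hnx : n ≤ x := by
    rw [hx]
    nlinarith [show 4 ≤ K by omega]
  have hclog : (Nat.clog 2 n : ℝ) + 1 ≤ 4 * Real.log x := by
    have h1 := clog_two_le n
    have h2 : Real.log n ≤ Real.log x := by
      rcases n.eq_zero_or_pos with rfl | hn
      · simpa using zero_le_one.trans hlog
      · exact Real.log_le_log (by exact_mod_cast hn) (by exact_mod_cast hnx)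
    linarith
  have hfx : (x : ℝ) ≤ f x := h0 x
  have hWx : 3 * (W (N * n) : ℝ) + 2 ≤ Q * f x := by
    have h1 := hW (N * n)
    have h2 : f (C * (N * n) + C) ≤ f x + f 0 := hf.le_add_of_le h0 (by
      rw [hx, ← mul_assoc]
      exact Nat.add_le_add (Nat.mul_le_mul_right n (by omega)) (by omega))
    have h3 := mul_le_mul_of_nonneg_left h2 (Nat.cast_nonneg (α := ℝ) C)
    have h4 : (n : ℝ) ≤ f x := le_trans (by exact_mod_cast hnx) hfx
    have h5 := mul_le_mul_of_nonneg_left h4 (show 0 ≤ 3 * D * N by positivity)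
    have h6 : C * f 0 * 1 ≤ C * f 0 * f x :=
      mul_le_mul_of_nonneg_left (by linarith) (mul_nonneg (Nat.cast_nonneg _) (hnn 0))
    push_cast at h1
    rw [hQ]
    nlinarith
  have hfirst : 2 * (((Nat.clog 2 n : ℝ) + 1) * (3 * (W (N * n) : ℝ) + 2)) ≤
      K * (Real.log x * f x) := by
    have h1 := mul_le_mul hclog hWx (by positivity) (by linarith)
    have h2 := mul_le_mul_of_nonneg_right hKQ
      (mul_nonneg (zero_le_one.trans hlog) (hnn x))
    linarith
  have hsecond : 2 * ((n : ℝ) * (N + 1) + 1) ≤ K * n + K := by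
    have : 2 * (n * (N + 1) + 1) ≤ K * n + K := by
      nlinarith [show 2 * (N + 1) ≤ K by omega]
    exact_mod_cast this
  rw [← hx]
  push_cast
  linarith

/-! ## The word problem of infinite cyclic groups -/

namespace CounterMachine

/-- A machine with a counter, which is a stack of equal letters; the stack `true` is the input. -/
def machine : StackMachine (Fin 1 × Bool) where
  Stacks := Bool
  Symbol _ := Fin 1 × Bool
  State := Option Bool
  finiteStacks := inferInstance
  finiteSymbol := inferInstance
  finiteState := inferInstance
  inputStack := true
  letter := Function.Embedding.refl _
  start := none
  accepting := {some true}
  transition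
    | some _, _ => none
    | none, h => match h true with
      | none => some (some (h false).isNone, fun _ => .keep)
      | some x => some (none, fun k => if k then .pop else match h false with
        | none => .push x
        | some y => if x.2 = y.2 then .push x else .pop)

/-- The configurations of the counter machine. -/
def cfg (q : Option Bool) (inp c : List (Fin 1 × Bool)) : machine.Cfg :=
  (q, fun k : Bool => cond k inp c)

theorem step_nil (c : List (Fin 1 × Bool)) :
    machine.step (cfg none [] c) = some (cfg (some c.isEmpty) [] c) := by
  change some (_, _) = some (_, _)
  congr 2
  · cases c <;> rfl

theorem step_cons (x : Fin 1 × Bool) (w c : List (Fin 1 × Bool)) :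
    machine.step (cfg none (x :: w) c) = some (cfg none w (match c.head? with
      | none => x :: c
      | some y => if x.2 = y.2 then x :: c else c.tail)) := by
  change some (_, _) = some (_, _)
  congr 2
  funext k
  cases k
  · rcases c with - | ⟨y, c⟩
    · rfl
    · change StackOp.apply (if x.2 = y.2 then .push x else .pop) (y :: c) =
        if x.2 = y.2 then x :: y :: c else c
      split_ifs <;> rfl
  · rfl

/-- The exponent sum of a word. -/
def expSum (w : List (Fin 1 × Bool)) : ℤ := (w.map fun x => if x.2 then 1 else -1).sum

/-- The counter holds the exponent sum of the part already read, in unary with a sign; for `n = 0`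
the sign `b` is immaterial. -/
theorem reach_done (w : List (Fin 1 × Bool)) (n : ℕ) (b : Bool) :
    ∃ (acc : Bool) (c : List (Fin 1 × Bool)),
      (acc = true ↔ expSum w + (if b then (n : ℤ) else -n) = 0) ∧
      ReachIn machine.step (w.length + 1) (cfg none w (.replicate n (0, b)))
        (cfg (some acc) [] c) := by
  induction w generalizing n b with
  | nil =>
    refine ⟨_, _, ?_, .single (step_nil _)⟩
    cases n <;> cases b <;> simp [expSum, List.replicate_succ] <;> omega
  | cons x w ih =>
    obtain ⟨i, b'⟩ := x
    obtain rfl : i = 0 := Subsingleton.elim _ _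
    have hs := step_cons (0, b') w (.replicate n (0, b))
    rcases n with - | n
    · obtain ⟨acc, c, h1, h2⟩ := ih 1 b'
      refine ⟨acc, c, h1.trans ?_, .head hs h2⟩
      cases b <;> cases b' <;> simp [expSum, add_comm]
    · by_cases hb : b' = b
      · subst hb
        obtain ⟨acc, c, h1, h2⟩ := ih (n + 2) b'
        refine ⟨acc, c, h1.trans ?_, .head hs ?_⟩
        · cases b' <;> simp [expSum] <;> constructor <;> intro h <;> linarith
        · simpa [List.replicate_succ] using h2
      · obtain ⟨acc, c, h1, h2⟩ := ih n b
        refine ⟨acc, c, h1.trans ?_, .head hs ?_⟩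
        · cases b' <;> cases b <;> simp [expSum] at hb ⊢ <;> constructor <;> intro h <;> linarith
        · simpa [List.replicate_succ, hb] using h2

theorem update_bool {inst : DecidableEq Bool} {Γ : Type} (l : List Γ) :
    Function.update (fun _ => []) true l = fun k => cond k l [] := by
  funext k
  cases k
  · exact Function.update_of_ne Bool.false_ne_true _ _
  · exact Function.update_self _ _ _

theorem decidesInTime : machine.DecidesInTime {w | expSum w = 0} fun n => n + 1 := by
  intro w
  obtain ⟨acc, c, h1, h2⟩ := reach_done w 0 true
  refine ⟨cfg (some acc) [] c, ?_, rfl, ?_⟩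
  · convert h2 using 1
    change (_, _) = (_, _)
    congr 1
    refine (update_bool _).trans ?_
    rw [show w.map machine.letter = w from List.map_id w]
    rfl
  · change some acc ∈ ({some true} : Set _) ↔ _
    simpa using h1

theorem lift_eq_zpow {G : Type*} [Group G] (z : G) (w : List (Fin 1 × Bool)) :
    FreeGroup.lift (fun _ : Fin 1 => z) (FreeGroup.mk w) = z ^ expSum w := by
  rw [FreeGroup.lift_mk]
  induction w with
  | nil => simp [expSum]
  | cons x w ih =>
    obtain ⟨i, b⟩ := x
    simp only [expSum] at ih
    cases b <;> simp [expSum, ih, zpow_add]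

end CounterMachine

theorem wordProblemInTime_cyclic {G : Type*} [Group G] {z : G} (hz : ∀ n : ℤ, z ^ n = 1 → n = 0)
    {f : ℕ → ℝ} (hf : ∀ n : ℕ, (n : ℝ) ≤ f n) : WordProblemInTime (fun _ : Fin 1 => z) f := by
  have h : trivialWords (fun _ : Fin 1 => z) = {w | CounterMachine.expSum w = 0} := by
    ext w
    simp only [trivialWords, Set.mem_ofPred_eq, CounterMachine.lift_eq_zpow]
    exact ⟨hz _, fun h => by rw [h, zpow_zero]⟩
  refine ⟨_, _, h ▸ StackMachine.toTM_decidesInTime _ CounterMachine.decidesInTime, 2,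
    by norm_num, fun n => ?_⟩
  have := (Nat.cast_nonneg _).trans (hf (2 * n + 2))
  push_cast
  linarith

/-! ## The word problem of free products -/

theorem map_prod_eq_map_lift {H P : Type*} [Group H] [Group P] {k : ℕ} (s : Fin k → H)
    (φ : H →* P) (u : List (Fin k × Bool)) :
    (u.map fun a => φ (cond a.2 (s a.1) (s a.1)⁻¹)).prod =
      φ (FreeGroup.lift s (FreeGroup.mk u)) := by
  rw [FreeGroup.lift_mk, map_list_prod, List.map_map]
  rfl

theorem IsGeneratingTuple.exists_word {H : Type*} [Group H] {k : ℕ} {s : Fin k → H}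
    (hs : IsGeneratingTuple s) (h : H) : ∃ u, FreeGroup.lift s (FreeGroup.mk u) = h := by
  obtain ⟨x, hx⟩ := FreeGroup.lift_surjective_iff_closure_range_eq_top.2 hs h
  exact ⟨x.toWord, by rw [FreeGroup.mk_toWord, hx]⟩

theorem WordProblemInTime.of_injective {G H : Type*} [Group G] [Group H] {m : ℕ} {s : Fin m → G}
    {f : ℕ → ℝ} (φ : G →* H) (hφ : Function.Injective φ)
    (h : WordProblemInTime (fun i => φ (s i)) f) : WordProblemInTime s f := by
  have e : trivialWords (fun i => φ (s i)) = trivialWords s := by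
    ext w
    have : FreeGroup.lift (fun i => φ (s i)) (FreeGroup.mk w) =
        φ (FreeGroup.lift s (FreeGroup.mk w)) :=
      DFunLike.congr_fun (FreeGroup.ext_hom (FreeGroup.lift fun i => φ (s i))
        (φ.comp (FreeGroup.lift s)) fun i => by simp) _
    simp only [trivialWords, Set.mem_ofPred_eq, this]
    exact map_eq_one_iff φ hφ
  unfold WordProblemInTime at h ⊢
  rwa [e] at h

-- The normal form theorem enters twice: it supplies a reduced word for each generator and inverse,
-- and it shows that a nonempty reduced word is nontrivial.
open FreeProductMachine Monoid in
theorem wordProblemInTime_coprodI {J : Type*} [Finite J] (G : J → Type*) [∀ j, Group (G j)]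
    {f : ℕ → ℝ} (hconv : NatConvex f) (hf : ∀ n : ℕ, (n : ℝ) ≤ f n)
    (hG : ∀ j, ∃ (m : ℕ) (s : Fin m → G j), IsGeneratingTuple s ∧ WordProblemInTime s f)
    {m : ℕ} (s : Fin m → CoprodI G) : WordProblemInTime s fun n => Real.log n * f n := by
  classical
  -- The data of a machine live in `Type`, whereas `J` may lie in any universe.
  obtain ⟨n, ⟨e⟩⟩ := Finite.exists_equiv_fin J
  choose k g hg M t hM ht using hG
  obtain ⟨W, C, D, hD, hW, hWt, hWa, hWle⟩ := hconv.exists_superadditive hf t ht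
  let α : Fin n → Type := fun i => Fin (k (e.symm i)) × Bool
  let val : ∀ i, List (α i) → G (e.symm i) := fun i u => FreeGroup.lift (g _) (FreeGroup.mk u)
  let v : ∀ i, α i → CoprodI G := fun i a =>
    CoprodI.of (cond a.2 (g (e.symm i) a.1) (g (e.symm i) a.1)⁻¹)
  let L : ∀ i, Set (List (α i)) := fun i => trivialWords (g (e.symm i))
  have hv : ∀ i u, (u.map (v i)).prod = CoprodI.of (val i u) := fun i u =>
    map_prod_eq_map_lift (g (e.symm i)) CoprodI.of u
  have hof : ∀ i (x : G (e.symm i)), (CoprodI.of x : CoprodI G) = 1 ↔ x = 1 := fun i x =>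
    map_eq_one_iff _ (CoprodI.of_injective _)
  have hL : ∀ i u, u ∈ L i ↔ (u.map (v i)).prod = 1 := fun i u => by
    rw [hv, hof]
    rfl
  let syl : (Σ i, List (α i)) → Σ j, G j := fun q => ⟨e.symm q.1, val q.1 q.2⟩
  have hprod : ∀ p : List (Σ i, List (α i)), wordProd v p =
      ((p.map syl).map fun l => (CoprodI.of l.2 : CoprodI G)).prod := fun p => by
    rw [wordProd, List.map_map]
    congr 1
    exact List.map_congr_left fun q _ => hv q.1 q.2
  have hfree : ∀ p, Reduced L p → wordProd v p = 1 → p = [] := by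
    intro p hp h1
    let w : CoprodI.Word G :=
      { toList := p.map syl
        ne_one := by
          intro l hl
          obtain ⟨q, hq, rfl⟩ := List.mem_map.1 hl
          exact hp.2 q hq
        chain_ne := by
          have := hp.1
          rw [List.isChain_map] at this ⊢
          exact this.imp fun a b hab h => hab (e.symm.injective h) }
    have hw : w.prod = 1 := (hprod p).symm.trans h1
    have hw : w = .empty := CoprodI.Word.equiv.symm.injective
      (show w.prod = CoprodI.Word.empty.prod by rw [hw, CoprodI.Word.prod_empty])
    exact List.map_eq_nil_iff.1 (congrArg CoprodI.Word.toList hw)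
  have hsyl : ∀ l : Σ j, G j, ∃ q : Σ i, List (α i), syl q = l := by
    rintro ⟨j, x⟩
    obtain ⟨i, rfl⟩ := e.symm.surjective j
    obtain ⟨u, hu⟩ := (hg (e.symm i)).exists_word x
    exact ⟨⟨i, u⟩, by simp only [syl, val, hu]⟩
  -- Each syllable of the normal form of `x` is spelled in the generators of its factor.
  have hred : ∀ x : CoprodI G, ∃ p, Reduced L p ∧ wordProd v p = x := by
    intro x
    choose r hr using hsyl
    obtain ⟨w, rfl⟩ := CoprodI.Word.equiv.symm.surjective x
    have hmap : (w.toList.map r).map syl = w.toList := by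
      rw [List.map_map]
      exact (List.map_congr_left fun l _ => hr l).trans (List.map_id _)
    refine ⟨w.toList.map r, ⟨?_, ?_⟩, ?_⟩
    · have := w.chain_ne
      rw [← hmap, List.isChain_map] at this
      rw [List.isChain_map]
      exact this.imp fun a b hab h => hab (congrArg e.symm h)
    · intro q hq hqL
      refine w.ne_one (syl q) ?_ hqL
      rw [← hmap]
      exact List.mem_map_of_mem hq
    · rw [hprod, hmap]
      rfl
  choose r hr hrx using hred
  let X := Fin m × Bool
  let word : X → List (Σ i, List (α i)) := fun x => r (cond x.2 (s x.1) (s x.1)⁻¹)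
  obtain ⟨N, hN⟩ := (Set.finite_range fun x => (enc [word x]).length).bddAbove
  let code : X → {l : List (Option (Σ i, α i)) // l.length ≤ N} :=
    fun x => ⟨enc [word x], hN ⟨x, rfl⟩⟩
  have hdec := machine_decidesInTime (code := code) (fun i => hM (e.symm i)) hL hW
    (fun i => hWt (e.symm i)) hWa hfree word (fun x => hr _) fun _ => rfl
  have hlang : {w : List X | (w.map fun x => wordProd v (word x)).prod = 1} = trivialWords s := by
    ext w
    simp only [word, hrx, trivialWords, Set.mem_ofPred_eq, FreeGroup.lift_mk]
    rfl
  rw [hlang] at hdec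
  exact ⟨_, _, StackMachine.toTM_decidesInTime _ hdec, growthLE_log_mul hconv hf hD hWle N⟩

/-! ## Graphs of groups with trivial edge groups -/

namespace GraphOfGroups

variable {V E : Type*} (𝒢 : GraphOfGroups V E) (T : Set E)

/-- The free factors of the fundamental group of a graph of groups with trivial edge groups. -/
def Factor : V ⊕ {e // e ∉ T} → Type _
  | .inl v => 𝒢.vertexGroup v
  | .inr _ => ULift (Multiplicative ℤ)

instance : ∀ j, Group (𝒢.Factor T j)
  | .inl v => 𝒢.vertexGroupGroup v
  | .inr _ => inferInstanceAs (Group (ULift (Multiplicative ℤ)))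

/-- A vertex group as a free factor. -/
def vertexFactor (v : V) : 𝒢.vertexGroup v →* Monoid.CoprodI (𝒢.Factor T) :=
  Monoid.CoprodI.of (M := 𝒢.Factor T) (i := .inl v)

/-- The generator of the factor of an edge outside the tree. -/
def edgeFactor (e : {e // e ∉ T}) : ULift (Multiplicative ℤ) →* Monoid.CoprodI (𝒢.Factor T) :=
  Monoid.CoprodI.of (M := 𝒢.Factor T) (i := .inr e)

open scoped Classical in
/-- The homomorphism from the big free product to the free product of the factors. -/
noncomputable def bigToFactors : 𝒢.BigFreeProduct →* Monoid.CoprodI (𝒢.Factor T) :=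
  Monoid.Coprod.lift (Monoid.CoprodI.lift (𝒢.vertexFactor T)) (FreeGroup.lift fun e =>
    if h : e ∈ T then 1 else 𝒢.edgeFactor T ⟨e, h⟩ (ULift.up (Multiplicative.ofAdd 1)))

/-- An edge relator can only come from `x = 1`, where it reads `t * 1 * t⁻¹ * 1`. -/
theorem normalClosure_le_ker (hedge : ∀ e : E, Subsingleton (𝒢.edgeGroup e)) :
    Subgroup.normalClosure (𝒢.relators T) ≤ (𝒢.bigToFactors T).ker := by
  refine Subgroup.normalClosure_le_normal ?_
  rintro r (⟨e, x, rfl⟩ | ⟨e, he, rfl⟩)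
  · have := hedge e
    obtain rfl := Subsingleton.elim x 1
    simp
  · simp [bigToFactors, stableLetter, he]

variable (hedge : ∀ e : E, Subsingleton (𝒢.edgeGroup e))

/-- The homomorphism from the fundamental group to the free product of the factors. -/
noncomputable def toFactors : 𝒢.FundamentalGroup T →* Monoid.CoprodI (𝒢.Factor T) :=
  QuotientGroup.lift _ (𝒢.bigToFactors T) (𝒢.normalClosure_le_ker T hedge)

/-- The quotient homomorphism from the big free product to the fundamental group. -/
def proj : 𝒢.BigFreeProduct →* 𝒢.FundamentalGroup T := QuotientGroup.mk' _

/-- The homomorphism from the free product of the factors to the fundamental group. -/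
noncomputable def ofFactors : Monoid.CoprodI (𝒢.Factor T) →* 𝒢.FundamentalGroup T :=
  Monoid.CoprodI.lift fun
    | .inl v => (𝒢.proj T).comp (𝒢.vertexIncl v)
    | .inr e => (zpowersHom _ (𝒢.proj T (𝒢.stableLetter e))).comp MulEquiv.ulift.toMonoidHom

/-- A left inverse suffices, as only injectivity of `toFactors` is used. It is checked on vertex
groups and stable letters; those of `T` are trivial on both sides. -/
theorem ofFactors_toFactors (x : 𝒢.FundamentalGroup T) :
    𝒢.ofFactors T (𝒢.toFactors T hedge x) = x := by
  suffices h : ((𝒢.ofFactors T).comp (𝒢.toFactors T hedge)) = MonoidHom.id _ from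
    DFunLike.congr_fun h x
  refine QuotientGroup.monoidHom_ext _ (Monoid.Coprod.hom_ext ?_ ?_)
  · refine Monoid.CoprodI.ext_hom _ _ fun v => MonoidHom.ext fun y => ?_
    change 𝒢.ofFactors T (𝒢.bigToFactors T (𝒢.vertexIncl v y)) = 𝒢.proj T (𝒢.vertexIncl v y)
    have : 𝒢.bigToFactors T (𝒢.vertexIncl v y) = 𝒢.vertexFactor T v y := by
      simp [bigToFactors, vertexIncl]
    rw [this]
    exact Monoid.CoprodI.lift_of (M := 𝒢.Factor T) (i := .inl v) _ y
  · refine FreeGroup.ext_hom _ _ fun e => ?_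
    change 𝒢.ofFactors T (𝒢.bigToFactors T (𝒢.stableLetter e)) = 𝒢.proj T (𝒢.stableLetter e)
    by_cases he : e ∈ T
    · have h1 : 𝒢.bigToFactors T (𝒢.stableLetter e) = 1 := by
        simp [bigToFactors, stableLetter, he]
      have h2 : 𝒢.proj T (𝒢.stableLetter e) = 1 :=
        (QuotientGroup.eq_one_iff _).2 (Subgroup.subset_normalClosure (.inr ⟨e, he, rfl⟩))
      rw [h1, h2, map_one]
    · have h1 : 𝒢.bigToFactors T (𝒢.stableLetter e) =
          𝒢.edgeFactor T ⟨e, he⟩ (ULift.up (Multiplicative.ofAdd 1)) := by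
        simp [bigToFactors, stableLetter, he]
      rw [h1]
      refine (Monoid.CoprodI.lift_of (M := 𝒢.Factor T) (i := .inr ⟨e, he⟩) _ _).trans ?_
      change 𝒢.proj T (𝒢.stableLetter e) ^ (1 : ℤ) = _
      rw [zpow_one]

theorem fg_of_vertexGroups [Finite V] [Finite E] (h : ∀ v, Group.FG (𝒢.vertexGroup v)) :
    Group.FG (𝒢.FundamentalGroup T) := by
  choose S hS hfin using fun v => Group.fg_iff.1 (h v)
  refine Group.fg_iff.2 ⟨𝒢.proj T '' ((⋃ v, 𝒢.vertexIncl v '' S v) ∪ Set.range 𝒢.stableLetter), ?_,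
    ((Set.finite_iUnion fun v => (hfin v).image _).union (Set.finite_range _)).image _⟩
  rw [← MonoidHom.map_closure, eq_top_iff, ← MonoidHom.range_eq_top.2 (QuotientGroup.mk'_surjective
    (Subgroup.normalClosure (𝒢.relators T))), MonoidHom.range_eq_map]
  refine Subgroup.map_mono fun x _ => ?_
  set K := Subgroup.closure ((⋃ v, 𝒢.vertexIncl v '' S v) ∪ Set.range 𝒢.stableLetter)
  have hV : ∀ v y, 𝒢.vertexIncl v y ∈ K := by
    intro v y
    have hy : y ∈ Subgroup.closure (S v) := by rw [hS v]; trivial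
    have : Subgroup.closure (S v) ≤ K.comap (𝒢.vertexIncl v) :=
      (Subgroup.closure_le _).2 fun z hz => Subgroup.subset_closure
        (.inl (Set.mem_iUnion.2 ⟨v, z, hz, rfl⟩))
    exact this hy
  have hE : ∀ y : FreeGroup E, Monoid.Coprod.inr y ∈ K := by
    intro y
    induction y using FreeGroup.induction_on with
    | C1 => simp
    | of e => exact Subgroup.subset_closure (.inr ⟨e, rfl⟩)
    | inv_of e h => simpa using h
    | mul a b ha hb => simpa using mul_mem ha hb
  induction x using Monoid.Coprod.induction_on with
  | inl y =>
    induction y using Monoid.CoprodI.induction_on with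
    | one => simp
    | of v y => exact hV v y
    | mul a b ha hb => simpa using mul_mem (ha trivial) (hb trivial)
  | inr y => exact hE y
  | mul a b ha hb => exact mul_mem (ha trivial) (hb trivial)

end GraphOfGroups

theorem isGeneratingTuple_ulift_int :
    IsGeneratingTuple fun _ : Fin 1 => ULift.up (Multiplicative.ofAdd (1 : ℤ)) := by
  refine (Subgroup.eq_top_iff' _).2 fun x => ?_
  have h : ULift.up (Multiplicative.ofAdd (1 : ℤ)) ^ x.down.toAdd = x := by
    ext
    simp
  rw [← h]
  exact Subgroup.zpow_mem _ (Subgroup.subset_closure (Set.mem_range_self (0 : Fin 1))) _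

theorem proposition1p3 {V E : Type*} [Finite V] [Finite E] (𝒢 : GraphOfGroups V E)
    (T : Set E) (hT : 𝒢.IsSpanningTree T)
    (hedge : ∀ e : E, Subsingleton (𝒢.edgeGroup e))
    (f : ℕ → ℝ) (hconv : NatConvex f) (hf : ∀ n : ℕ, (n : ℝ) ≤ f n)
    (hvertex : ∀ v : V, ∃ (m : ℕ) (s : Fin m → 𝒢.vertexGroup v),
      IsGeneratingTuple s ∧ WordProblemInTime s f) :
    Group.FG (𝒢.FundamentalGroup T) ∧
    ∀ (m : ℕ) (s : Fin m → 𝒢.FundamentalGroup T), IsGeneratingTuple s →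
      WordProblemInTime s (fun n => Real.log n * f n) := by
  refine ⟨𝒢.fg_of_vertexGroups T fun v => ?_, fun m s _ => ?_⟩
  · obtain ⟨k, g, hg, -⟩ := hvertex v
    exact Group.fg_iff.2 ⟨_, hg, Set.finite_range g⟩
  · refine .of_injective (𝒢.toFactors T hedge)
      (Function.LeftInverse.injective (𝒢.ofFactors_toFactors T hedge))
      (wordProblemInTime_coprodI _ hconv hf ?_ _)
    rintro (v | e)
    · exact hvertex v
    · refine ⟨1, fun _ => ULift.up (Multiplicative.ofAdd 1), isGeneratingTuple_ulift_int,
        wordProblemInTime_cyclic (fun n hn => ?_) hf⟩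
      have := congrArg (fun x : ULift (Multiplicative ℤ) => x.down.toAdd)
        (show ULift.up (Multiplicative.ofAdd (1 : ℤ)) ^ n = 1 from hn)
      simpa using this
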